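/- **Standing assumptions and notation.** Let $\mathbf D$ be a finite algebra (over an arbitrary finitary signature) which has a bounded lattice reduct $\langle D,\wedge,\vee,0,1\rangle$ and is semi-primal: for every $n\ge 1$, every operation $D^n\to D$ that preserves all subalgebras of $\mathbf D$ is term-definable in $\mathbf D$. Let $\mathbb S(\mathbf D)$ be the set of subalgebras of $\mathbf D$ ordered by inclusion, and let $\mathcal A$ be the variety generated by $\mathbf D$, as a category with all homomorphisms. For $d\in D$ let $T_d$ be the (term-definable) unary operation with $T_d(d)=1$ and $T_d(x)=0$ for $x\ne d$. Let $\mathsf{Stone}$ be the category of Stone spaces with continuous maps. The category $\mathsf{Stone}_{\mathbf D}$ has as objects the pairs $(X,\mathbf v)$, where $X$ is a Stone space and $\mathbf v\colon X\to\mathbb S(\mathbf D)$ is a map such that $\{x\mid \mathbf v(x)\le \mathbf S\}$ is closed for every $\mathbf S\in\mathbb S(\mathbf D)$; its morphisms $(X_1,\mathbf v_1)\to(X_2,\mathbf v_2)$ are the continuous maps $f\colon X_1\to X_2$ with $\mathbf v_2(f(x))\le \mathbf v_1(x)$ for all $x$. The contravariant functor $\Sigma'\colon\mathcal A\to\mathsf{Stone}_{\mathbf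 D}$ sends $\mathbf A$ to the set of homomorphisms $u\colon\mathbf A\to\mathbf D$, with the topology generated by the sets $\{u\mid u(a)=d\}$, together with $u\mapsto u(A)$. The contravariant functor $\Pi'\colon\mathsf{Stone}_{\mathbf D}\to\mathcal A$ sends $(X,\mathbf v)$ to the algebra of all continuous $\alpha\colon X\to D$ ($D$ discrete) with $\alpha(x)\in\mathbf v(x)$ for all $x$, with componentwise operations. Both act on morphisms by precomposition. Let $\Sigma\colon\mathsf{BA}\to\mathsf{Stone}$ and $\Pi\colon\mathsf{Stone}\to\mathsf{BA}$ be the functors of Stone duality, $\Sigma(\mathbf B)=\mathsf{BA}(\mathbf B,\mathbf 2)$ and $\Pi(X)=\mathsf{Stone}(X,\mathbf 2)$. For $\mathbf S\in\mathbb S(\mathbf D)$ consider the following functors. * $\mathsf V^{\mathbf S}\colon\mathsf{Stone}\to\mathsf{Stone}_{\mathbf D}$ sends $X$ to $X$ with the constant map $\mathbf v=\mathbf S$; $\mathsf C^{\mathbf S}\colon\mathsf{Stone}_{\mathbf D}\to\mathsf{Stone}$ sends $(X,\mathbf v)$ to the closed subspace $\{x\mid\mathbf v(x)\le\mathbf S\}$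 and restricts morphisms. * $\mathfrak P_{\mathbf S}\colon\mathsf{BA}\to\mathcal A$ sends $\mathbf B$ to the Boolean power $\mathbf S[\mathbf B]$, the algebra of continuous functions from $\Sigma(\mathbf B)$ to the discrete algebra $\mathbf S$. * $\mathsf K_{\mathbf S}\colon\mathcal A\to\mathsf{BA}$ sends $\mathbf A$ to the Boolean skeleton of $\mathbf A/\theta_{\mathbf S}$. Here $\theta_{\mathbf S}$ is the intersection of the kernels of all homomorphisms $\mathbf A\to\mathbf D$ with image contained in $\mathbf S$, and the Boolean skeleton of an algebra is the set of all elements $a$ with $T_1(a)=a$, with the inherited lattice operations and negation $T_0$. For a functor $\mathsf T\colon\mathsf{Stone}\to\mathsf{Stone}$, its lifting $\mathsf T'\colon\mathsf{Stone}_{\mathbf D}\to\mathsf{Stone}_{\mathbf D}$ is given by the coends $$\mathsf T'(X,\mathbf v)=\int^{\mathbf S\in\mathbb S(\mathbf D)}\mathsf V^{\mathbf S}\,\mathsf T\,\mathsf C^{\mathbf S}(X,\mathbf v),$$ and for a functor $\mathsf L\colon\mathsf{BA}\to\mathsf{BA}$, its lifting $\mathsf L'\colon\mathcal A\to\mathcal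 A$ is given by the ends $$\mathsf L'(\mathbf A)=\int_{\mathbf S\in\mathbb S(\mathbf D)}\mathfrak P_{\mathbf S}\,\mathsf L\,\mathsf K_{\mathbf S}(\mathbf A).$$ The (co)end diagrams are formed with the canonical maps for $\mathbf S_1\le\mathbf S_2$ (identities $\mathsf V^{\mathbf S_2}X\to\mathsf V^{\mathbf S_1}X$, inclusions $\mathsf C^{\mathbf S_1}\to\mathsf C^{\mathbf S_2}$ and $\mathfrak P_{\mathbf S_1}\to\mathfrak P_{\mathbf S_2}$, and the maps $\mathsf K_{\mathbf S_2}\to\mathsf K_{\mathbf S_1}$ induced by the projections); these coends and ends exist, and $\mathsf T'$ and $\mathsf L'$ act on morphisms by the universal properties. **Theorem.** If $\mathsf T\colon\mathsf{Stone}\to\mathsf{Stone}$ and $\mathsf L\colon\mathsf{BA}\to\mathsf{BA}$ are dual, that is, if there is a natural isomorphism $\mathsf L\cong\Pi\mathsf T\Sigma$, then their liftings $\mathsf T'$ and $\mathsf L'$ are dual as well, that is, there is a natural isomorphism $\mathsf L'\cong\Pi'\mathsf T'\Sigma'$. -/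

import Mathlib

open CategoryTheory Opposite FirstOrder

universe u v w

namespace SemiPrimal

noncomputable section

/-! ### Algebras: first-order structures over a language without relation symbols

Operation symbols are `ℒ.Functions n`, terms in `n` variables are `ℒ.Term (Fin n)`, subalgebras of
`D` are `ℒ.Substructure D`, homomorphisms are `A →[ℒ] B`. -/

section Algebras

variable (ℒ : FirstOrder.Language.{v, w}) (D : Type u) [ℒ.Structure D]

/-- A (finite) algebra is semi-primal if every operation of positive arity on its carrier which
preserves all subalgebras is term-definable. Finiteness is assumed separately, as `[Finite D]`. -/
class IsSemiPrimal : Prop where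
  exists_term : ∀ (n : ℕ), 1 ≤ n → ∀ f : (Fin n → D) → D,
    (∀ S : ℒ.Substructure D, ∀ x : Fin n → D, (∀ i, x i ∈ S) → f x ∈ S) →
      ∃ t : ℒ.Term (Fin n), ∀ x : Fin n → D, t.realize x = f x

/-- The bounded lattice `D` is a reduct of the algebra `D`: the bounded lattice operations are
given by terms of the language (the constants by closed terms). -/
class BoundedLatticeReduct [Lattice D] [BoundedOrder D] where
  infTerm : ℒ.Term (Fin 2)
  supTerm : ℒ.Term (Fin 2)
  botTerm : ℒ.Term (Fin 0)
  topTerm : ℒ.Term (Fin 0)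
  realize_inf : ∀ x : Fin 2 → D, infTerm.realize x = x 0 ⊓ x 1
  realize_sup : ∀ x : Fin 2 → D, supTerm.realize x = x 0 ⊔ x 1
  realize_bot : ∀ x : Fin 0 → D, botTerm.realize x = ⊥
  realize_top : ∀ x : Fin 0 → D, topTerm.realize x = ⊤

/-- `A` belongs to the variety generated by `D`: every equation valid in `D` is valid in `A`. -/
def InVariety (A : Type u) [ℒ.Structure A] : Prop :=
  ∀ (n : ℕ) (s t : ℒ.Term (Fin n)), (∀ x : Fin n → D, s.realize x = t.realize x) →
    ∀ x : Fin n → A, s.realize x = t.realize x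

/-- An algebra in the variety generated by `D`. -/
structure Variety where
  carrier : Type u
  [str : ℒ.Structure carrier]
  inVariety : InVariety ℒ D carrier

attribute [instance] Variety.str

/-- The variety generated by `D` as a category; the morphisms are all homomorphisms. -/
instance : Category (Variety.{u} ℒ D) where
  Hom A B := A.carrier →[ℒ] B.carrier
  id A := FirstOrder.Language.Hom.id ℒ A.carrier
  comp f g := g.comp f

variable {ℒ D}

theorem Variety.hom_ext {A B : Variety.{u} ℒ D} {f g : A ⟶ B}
    (h : ∀ a : A.carrier, FirstOrder.Language.Hom.toFun f a = FirstOrder.Language.Hom.toFun g a) :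
    f = g :=
  FirstOrder.Language.Hom.ext h

theorem inVariety_self : InVariety ℒ D D := fun _ _ _ h => h

theorem InVariety.of_separating {A : Type u} [ℒ.Structure A] {ι : Type*} {B : ι → Type u}
    [∀ i, ℒ.Structure (B i)] (hB : ∀ i, InVariety ℒ D (B i)) (φ : ∀ i, A →[ℒ] B i)
    (hφ : ∀ a b : A, (∀ i, φ i a = φ i b) → a = b) : InVariety ℒ D A := by
  intro n s t h x
  refine hφ _ _ fun i => ?_
  rw [← FirstOrder.Language.HomClass.realize_term, ← FirstOrder.Language.HomClass.realize_term]
  exact hB i n s t h _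

theorem InVariety.of_surjective {A B : Type u} [ℒ.Structure A] [ℒ.Structure B]
    (hA : InVariety ℒ D A) (φ : A →[ℒ] B) (hφ : Function.Surjective φ) : InVariety ℒ D B := by
  intro n s t h y
  choose x hx using fun i => hφ (y i)
  have : y = φ ∘ x := funext fun i => (hx i).symm
  rw [this, FirstOrder.Language.HomClass.realize_term, FirstOrder.Language.HomClass.realize_term, hA n s t h]

theorem InVariety.substructure {A : Type u} [ℒ.Structure A] (hA : InVariety ℒ D A)
    (S : ℒ.Substructure A) : InVariety ℒ D S :=
  .of_separating (ι := Unit) (fun _ => hA) (fun _ => S.subtype.toHom)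
    fun _ _ h => Subtype.ext (h ())

end Algebras

/-! ### Stone spaces of homomorphisms -/

/-- The topology generated by the sets `[a : d] = {u | u a = d}`. -/
@[reducible] def evalTopology {H A D : Type*} (e : H → A → D) : TopologicalSpace H :=
  TopologicalSpace.generateFrom {U | ∃ a d, U = {u | e u a = d}}

section EvalTopology

variable {H A D : Type*} (e : H → A → D)

theorem isClopen_eval (a : A) (p : Set D) :
    @IsClopen H (evalTopology e) {u | e u a ∈ p} := by
  let _ := evalTopology e
  have key : ∀ p : Set D, IsOpen {u | e u a ∈ p} := by
    intro p
    have : {u | e u a ∈ p} = ⋃ d ∈ p, {u | e u a = d} := by ext u; simp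
    rw [this]
    exact isOpen_biUnion fun d _ => TopologicalSpace.isOpen_generateFrom_of_mem ⟨a, d, rfl⟩
  exact ⟨⟨key pᶜ⟩, key p⟩

theorem evalTopology_t2 (he : Function.Injective e) : @T2Space H (evalTopology e) := by
  let _ := evalTopology e
  refine ⟨fun u v huv => ?_⟩
  obtain ⟨a, ha⟩ := Function.ne_iff.mp (he.ne huv)
  refine ⟨{x | e x a ∈ ({e u a} : Set D)}, {x | e x a ∈ ({e u a} : Set D)ᶜ},
    (isClopen_eval e a _).2, (isClopen_eval e a _).2, rfl, fun h => ha h.symm, ?_⟩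
  exact Set.disjoint_left.mpr fun x hx hx' => hx' hx

theorem evalTopology_totallyDisconnected (he : Function.Injective e) :
    @TotallyDisconnectedSpace H (evalTopology e) := by
  let _ := evalTopology e
  refine @TotallySeparatedSpace.totallyDisconnectedSpace H _
    (totallySeparatedSpace_iff_exists_isClopen.mpr fun u v huv => ?_)
  obtain ⟨a, ha⟩ := Function.ne_iff.mp (he.ne huv)
  exact ⟨_, isClopen_eval e a {e u a}, rfl, fun h => ha h.symm⟩

/-- Compactness, provided that maps `A → D` which agree on every finite set with some member of
`H` come from `H`. -/
theorem evalTopology_compact [Finite D]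
    (hc : ∀ f : A → D, (∀ F : Finset A, ∃ u, ∀ a ∈ F, e u a = f a) → ∃ u, e u = f) :
    @CompactSpace H (evalTopology e) := by
  let _ := evalTopology e
  let _ : TopologicalSpace D := ⊥
  have : DiscreteTopology D := ⟨rfl⟩
  have hind : Topology.IsInducing e := by
    refine ⟨le_antisymm ?_ ?_⟩
    · refine continuous_iff_le_induced.mp (continuous_pi fun a => ?_)
      exact ⟨fun p _ => (isClopen_eval e a p).2⟩
    · refine le_generateFrom ?_
      rintro _ ⟨a, d, rfl⟩
      exact ⟨_, (isOpen_discrete ({d} : Set D)).preimage (continuous_apply a), rfl⟩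
  have hcl : IsClosed (Set.range e) := by
    refine isClosed_of_closure_subset fun f hf => hc f fun F => ?_
    have hO : IsOpen ((F : Set A).pi fun a => ({f a} : Set D)) :=
      isOpen_set_pi F.finite_toSet fun _ _ => isOpen_discrete _
    obtain ⟨_, hg, u, rfl⟩ := mem_closure_iff.mp hf _ hO fun _ _ => rfl
    exact ⟨u, fun a ha => hg a ha⟩
  exact ⟨hind.isCompact_iff.mpr (by simpa using hcl.isCompact)⟩

theorem continuous_evalTopology {X : Type*} [TopologicalSpace X] (f : X → H)
    (hf : ∀ a d, IsOpen {x | e (f x) a = d}) : @Continuous X H _ (evalTopology e) f := by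
  refine continuous_generateFrom_iff.mpr ?_
  rintro _ ⟨a, d, rfl⟩
  exact hf a d

end EvalTopology

/-! ### Stone duality for Boolean algebras -/

/-- The Stone space of a Boolean algebra: homomorphisms to the two-element Boolean algebra. -/
def Spec (B : BoolAlg.{u}) : Type u := BoundedLatticeHom B Bool

namespace Spec

variable (B : BoolAlg.{u})

instance : FunLike (Spec B) B Bool := inferInstanceAs (FunLike (BoundedLatticeHom B Bool) B Bool)

instance : BoundedLatticeHomClass (Spec B) B Bool :=
  inferInstanceAs (BoundedLatticeHomClass (BoundedLatticeHom B Bool) B Bool)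

instance : TopologicalSpace (Spec B) := evalTopology fun (u : Spec B) (b : B) => u b

instance : T2Space (Spec B) := evalTopology_t2 _ DFunLike.coe_injective

instance : TotallyDisconnectedSpace (Spec B) :=
  evalTopology_totallyDisconnected _ DFunLike.coe_injective

instance : CompactSpace (Spec B) := by
  classical
  refine evalTopology_compact _ fun f hf => ?_
  refine ⟨(⟨⟨⟨f, fun a b => ?_⟩, fun a b => ?_⟩, ?_, ?_⟩ : BoundedLatticeHom B Bool), rfl⟩
  · obtain ⟨u, hu⟩ := hf {a, b, a ⊔ b}
    rw [← hu a (by simp), ← hu b (by simp), ← hu (a ⊔ b) (by simp)]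
    exact map_sup u a b
  · obtain ⟨u, hu⟩ := hf {a, b, a ⊓ b}
    change f (a ⊓ b) = f a ⊓ f b
    rw [← hu a (by simp), ← hu b (by simp), ← hu (a ⊓ b) (by simp)]
    exact map_inf u a b
  · obtain ⟨u, hu⟩ := hf {⊤}
    change f ⊤ = ⊤
    rw [← hu ⊤ (by simp)]
    exact map_top u
  · obtain ⟨u, hu⟩ := hf {⊥}
    change f ⊥ = ⊥
    rw [← hu ⊥ (by simp)]
    exact map_bot u

variable {B}

/-- Precomposition with a homomorphism. -/
def comap {B₁ B₂ : BoolAlg.{u}} (h : B₁ ⟶ B₂) : C(Spec B₂, Spec B₁) where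
  toFun u := BoundedLatticeHom.comp (β := B₂) u h.hom
  continuous_toFun := continuous_evalTopology _ _ fun a d => (isClopen_eval _ (h.hom a) {d}).2

end Spec

/-- The functor `Σ` from Boolean algebras to Stone spaces. -/
def stoneSpec : BoolAlg.{u} ⥤ Profinite.{u}ᵒᵖ where
  obj B := op (Profinite.of (Spec B))
  map h := (CompHausLike.ofHom _ (Spec.comap h)).op
  map_id _ := rfl
  map_comp _ _ := rfl

section BoolFunctions

variable (X : Type*) [TopologicalSpace X]

instance : Max (LocallyConstant X Bool) := ⟨fun f g => ⟨fun x => f x ⊔ g x, f.2.comp₂ g.2 _⟩⟩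
instance : Min (LocallyConstant X Bool) := ⟨fun f g => ⟨fun x => f x ⊓ g x, f.2.comp₂ g.2 _⟩⟩
instance : LE (LocallyConstant X Bool) := ⟨fun f g => (f : X → Bool) ≤ g⟩
instance : LT (LocallyConstant X Bool) := ⟨fun f g => (f : X → Bool) < g⟩
instance : Top (LocallyConstant X Bool) := ⟨.const X ⊤⟩
instance : Bot (LocallyConstant X Bool) := ⟨.const X ⊥⟩
instance : Compl (LocallyConstant X Bool) := ⟨fun f => f.map compl⟩
instance : SDiff (LocallyConstant X Bool) := ⟨fun f g => ⟨fun x => f x \ g x, f.2.comp₂ g.2 _⟩⟩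
instance : HImp (LocallyConstant X Bool) := ⟨fun f g => ⟨fun x => f x ⇨ g x, f.2.comp₂ g.2 _⟩⟩

/-- Continuous functions to the two-element Boolean algebra, with componentwise operations. -/
instance : BooleanAlgebra (LocallyConstant X Bool) :=
  Function.Injective.booleanAlgebra (β := X → Bool) (fun f => f) DFunLike.coe_injective
    Iff.rfl Iff.rfl (fun _ _ => rfl) (fun _ _ => rfl) rfl rfl (fun _ => rfl) (fun _ _ => rfl)
    (fun _ _ => rfl)

end BoolFunctions

/-- The functor `Π` from Stone spaces to Boolean algebras: `X` is sent to the Boolean algebra of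
continuous functions from `X` to the discrete space `Bool`. -/
def stoneAlg : Profinite.{u}ᵒᵖ ⥤ BoolAlg.{u} where
  obj X := BoolAlg.of (LocallyConstant X.unop Bool)
  map f := BoolAlg.ofHom
    { toFun := LocallyConstant.comap f.unop.hom.hom
      map_sup' := fun _ _ => rfl
      map_inf' := fun _ _ => rfl
      map_top' := rfl
      map_bot' := rfl }

/-! ### The category `Stone_D` -/

section StoneD

variable (ℒ : FirstOrder.Language.{v, w}) (D : Type u) [ℒ.Structure D]

/-- Stone spaces whose points are labelled by subalgebras of `D`, such that the set of points
labelled by a subalgebra of `S` is closed, for every subalgebra `S`. -/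
structure StoneD where
  space : Profinite.{u}
  val : space → ℒ.Substructure D
  isClosed_le : ∀ S : ℒ.Substructure D, IsClosed {x | val x ≤ S}

variable {ℒ D}

/-- Continuous maps which do not increase the label. -/
@[ext] structure StoneD.Hom (X Y : StoneD.{u} ℒ D) where
  hom : X.space ⟶ Y.space
  val_le : ∀ x : X.space, Y.val (hom x) ≤ X.val x

instance : Category (StoneD.{u} ℒ D) where
  Hom X Y := StoneD.Hom X Y
  id X := ⟨𝟙 _, fun _ => le_rfl⟩
  comp f g := ⟨f.hom ≫ g.hom, fun x => (g.val_le (f.hom x)).trans (f.val_le x)⟩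

@[ext] theorem StoneD.hom_ext {X Y : StoneD.{u} ℒ D} {f g : X ⟶ Y} (h : f.hom = g.hom) : f = g :=
  StoneD.Hom.ext h

variable (ℒ D)

/-- The functors `V^S : Stone ⥤ Stone_D`, giving every point the label `S`, together with the
transformations `V^S₂ ⟶ V^S₁` for `S₁ ≤ S₂` which are the identity on points. -/
def functorV : (ℒ.Substructure D)ᵒᵖ ⥤ Profinite.{u} ⥤ StoneD.{u} ℒ D where
  obj S :=
    { obj := fun X => ⟨X, fun _ => S.unop, fun _ => isClosed_const⟩
      map := fun f => ⟨f, fun _ => le_rfl⟩ }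
  map h := { app := fun X => ⟨𝟙 X, fun _ => leOfHom h.unop⟩ }

/-- The closed subspace `{x | val x ≤ S}` as a Stone space. -/
def StoneD.sub (X : StoneD.{u} ℒ D) (S : ℒ.Substructure D) : Profinite.{u} :=
  have : CompactSpace {x : X.space // X.val x ≤ S} :=
    isCompact_iff_compactSpace.mp (X.isClosed_le S).isCompact
  Profinite.of {x : X.space // X.val x ≤ S}

/-- The functors `C^S : Stone_D ⥤ Stone`, sending `X` to its subspace `{x | val x ≤ S}` and
restricting morphisms, together with the inclusions `C^S₁ ⟶ C^S₂` for `S₁ ≤ S₂`. -/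
def functorC : ℒ.Substructure D ⥤ StoneD.{u} ℒ D ⥤ Profinite.{u} where
  obj S :=
    { obj := fun X => X.sub ℒ D S
      map := fun {X Y} f => ConcreteCategory.ofHom (X := X.sub ℒ D S) (Y := Y.sub ℒ D S)
        ⟨fun x => ⟨f.hom x.1, (f.val_le x.1).trans x.2⟩,
          (f.hom.hom.hom.continuous.comp continuous_subtype_val).subtype_mk _⟩ }
  map {S₁ S₂} h :=
    { app := fun X => ConcreteCategory.ofHom (X := X.sub ℒ D S₁) (Y := X.sub ℒ D S₂)
        ⟨fun x => ⟨x.1, x.2.trans (leOfHom h)⟩, continuous_subtype_val.subtype_mk _⟩ }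

end StoneD

/-! ### The functors `Σ'` and `Π'` -/

section Duality

variable (ℒ : FirstOrder.Language.{v, w}) [ℒ.IsAlgebraic] (D : Type u) [ℒ.Structure D]

/-- The homomorphisms from `A` to `D`. -/
def Points (A : Type u) [ℒ.Structure A] : Type u := A →[ℒ] D

variable {ℒ D}

namespace Points

variable {A : Type u} [ℒ.Structure A]

instance : FunLike (Points ℒ D A) A D := inferInstanceAs (FunLike (A →[ℒ] D) A D)

instance : TopologicalSpace (Points ℒ D A) := evalTopology fun (u : Points ℒ D A) (a : A) => u a

instance : T2Space (Points ℒ D A) := evalTopology_t2 _ DFunLike.coe_injective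

instance : TotallyDisconnectedSpace (Points ℒ D A) :=
  evalTopology_totallyDisconnected _ DFunLike.coe_injective

instance [Finite D] : CompactSpace (Points ℒ D A) := by
  classical
  refine evalTopology_compact _ fun f hf => ?_
  refine ⟨(⟨f, fun {n} g x => ?_, fun r => isEmptyElim r⟩ : A →[ℒ] D), rfl⟩
  obtain ⟨u, hu⟩ := hf (insert (FirstOrder.Language.Structure.funMap g x) (Finset.univ.image x))
  have h1 : f ∘ x = u ∘ x := funext fun i => (hu (x i) (by simp)).symm
  rw [← hu _ (by simp), h1]
  exact FirstOrder.Language.HomClass.map_fun (L := ℒ) (F := A →[ℒ] D) u g x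

end Points

/-- Componentwise operations on continuous functions to a discrete algebra. -/
instance (X : Type*) [TopologicalSpace X] (M : Type*) [ℒ.Structure M] :
    ℒ.Structure (LocallyConstant X M) where
  funMap {n} g α := ⟨fun x => FirstOrder.Language.Structure.funMap g fun i => α i x, by
    let _ : TopologicalSpace M := ⊥
    have : DiscreteTopology M := ⟨rfl⟩
    have h : Continuous fun x (i : Fin n) => α i x := continuous_pi fun i => (α i).continuous
    have := (IsLocallyConstant.iff_continuous (fun x (i : Fin n) => α i x)).mpr h
    exact this.comp _⟩

/-- Evaluation at a point. -/
def evalHom {X : Type*} [TopologicalSpace X] {M : Type*} [ℒ.Structure M] (x : X) :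
    LocallyConstant X M →[ℒ] M where
  toFun α := α x
  map_fun' _ _ := rfl
  map_rel' r := isEmptyElim r

theorem inVariety_locallyConstant {X : Type u} [TopologicalSpace X] {M : Type u} [ℒ.Structure M]
    (hM : InVariety ℒ D M) : InVariety ℒ D (LocallyConstant X M) :=
  .of_separating (fun _ : X => hM) evalHom fun _ _ h => LocallyConstant.ext h

variable (ℒ D)

/-- The functor `Σ'`: an algebra `A` is sent to the Stone space of homomorphisms `A → D`, labelled
by their images. -/
def functorSigma [Finite D] : Variety.{u} ℒ D ⥤ (StoneD.{u} ℒ D)ᵒᵖ where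
  obj A := op
    { space := Profinite.of (Points ℒ D A.carrier)
      val := fun u => FirstOrder.Language.Hom.range (M := A.carrier) u
      isClosed_le := fun S => by
        have : {u : Points ℒ D A.carrier | FirstOrder.Language.Hom.range (M := A.carrier) u ≤ S} =
            ⋂ a : A.carrier, {u | u a ∈ (S : Set D)} := by
          ext u
          simp only [Set.mem_ofPred_eq, Set.mem_iInter]
          exact ⟨fun h a => h ⟨a, rfl⟩, fun h d ⟨a, ha⟩ => ha ▸ h a⟩
        exact this ▸ isClosed_iInter fun a => (isClopen_eval _ a _).1 }
  map {A B} h := Quiver.Hom.op (V := StoneD ℒ D)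
    { hom := CompHausLike.ofHom _
        { toFun := fun u => FirstOrder.Language.Hom.comp (N := B.carrier) u h
          continuous_toFun := continuous_evalTopology _ _ fun a d =>
            (isClopen_eval _ (FirstOrder.Language.Hom.toFun h a) {d}).2 }
      val_le := fun _ => FirstOrder.Language.Hom.range_comp_le_range _ _ }

/-- The algebra of all continuous functions `α` from `X` to `D` with `α x ∈ val x` for all `x`. -/
def StoneD.sections (X : StoneD.{u} ℒ D) : ℒ.Substructure (LocallyConstant X.space D) where
  carrier := {α | ∀ x, α x ∈ X.val x}
  fun_mem {_} g α hα x := (X.val x).fun_mem g (fun i => α i x) fun i => hα i x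

/-- The functor `Π'`, acting on morphisms by precomposition. -/
def functorPi : (StoneD.{u} ℒ D)ᵒᵖ ⥤ Variety.{u} ℒ D where
  obj X := ⟨X.unop.sections, (inVariety_locallyConstant inVariety_self).substructure _⟩
  map {X Y} f :=
    { toFun := fun α => ⟨α.1.comap f.unop.hom.hom.hom, fun x => f.unop.val_le x (α.2 _)⟩
      map_fun' := fun _ _ => rfl
      map_rel' := fun r => isEmptyElim r }

/-- The functors `𝔓_S`: a Boolean algebra `B` is sent to the Boolean power `S[B]`, the algebra of
continuous functions from the Stone space of `B` to the discrete algebra `S`. For `S₁ ≤ S₂` there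
is the inclusion of `S₁[B]` into `S₂[B]`. -/
def functorP : ℒ.Substructure D ⥤ BoolAlg.{u} ⥤ Variety.{u} ℒ D where
  obj S :=
    { obj := fun B => ⟨LocallyConstant (Spec B) S,
        inVariety_locallyConstant (inVariety_self.substructure S)⟩
      map := fun h =>
        { toFun := LocallyConstant.comap (Spec.comap h)
          map_fun' := fun _ _ => rfl
          map_rel' := fun r => isEmptyElim r } }
  map h :=
    { app := fun _ =>
        { toFun := LocallyConstant.map fun x => ⟨x.1, leOfHom h x.2⟩
          map_fun' := fun _ _ => rfl
          map_rel' := fun r => isEmptyElim r } }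

end Duality

/-! ### The functors `K_S` -/

section Quotient

variable {ℒ : FirstOrder.Language.{v, w}} [ℒ.IsAlgebraic] {D : Type u} [ℒ.Structure D]

/-- The congruence on `A` which is the intersection of the kernels of all homomorphisms from `A` to
`D` with image in `S`; these homomorphisms are the points of the closed subspace corresponding to
`S` of the dual of `A`. -/
def subSetoid (S : ℒ.Substructure D) (A : Type u) [ℒ.Structure A] : Setoid A where
  r a b := ∀ u : A →[ℒ] D, u.range ≤ S → u a = u b
  iseqv := ⟨fun _ _ _ => rfl, fun h u hu => (h u hu).symm,
    fun h h' u hu => (h u hu).trans (h' u hu)⟩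

instance (S : ℒ.Substructure D) (A : Type u) [i : ℒ.Structure A] :
    ℒ.Prestructure (subSetoid S A) where
  toStructure := i
  fun_equiv {_ f} x y h u hu := by
    rw [u.map_fun, u.map_fun]
    exact congrArg _ (funext fun k => h k u hu)
  rel_equiv {_ r} := isEmptyElim r

/-- The projection to the quotient algebra. -/
def subMk (S : ℒ.Substructure D) (A : Type u) [ℒ.Structure A] :
    A →[ℒ] Quotient (subSetoid S A) where
  toFun a := ⟦a⟧
  map_fun' f x := (FirstOrder.Language.funMap_quotient_mk' (subSetoid S A) f x).symm
  map_rel' r := isEmptyElim r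

/-- The homomorphism between quotients induced by a homomorphism, where `S₁ ≤ S₂`. -/
def subMap {S₁ S₂ : ℒ.Substructure D} (h : S₁ ≤ S₂) {A B : Type u} [ℒ.Structure A] [ℒ.Structure B]
    (φ : A →[ℒ] B) : Quotient (subSetoid S₂ A) →[ℒ] Quotient (subSetoid S₁ B) where
  toFun := Quotient.map φ fun a b hab u hu =>
    hab (u.comp φ) ((FirstOrder.Language.Hom.range_comp_le_range φ u).trans (hu.trans h))
  map_fun' f x := by
    obtain ⟨y, rfl⟩ : ∃ y : _ → A, x = fun i => ⟦y i⟧ :=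
      ⟨fun i => (x i).out, funext fun i => (Quotient.out_eq _).symm⟩
    rw [FirstOrder.Language.funMap_quotient_mk']
    refine Eq.trans ?_ (FirstOrder.Language.funMap_quotient_mk' (subSetoid S₁ B) f _).symm
    exact congrArg _ (φ.map_fun f y)
  map_rel' r := isEmptyElim r

variable (ℒ D)

/-- The quotient of an algebra by the congruence attached to the subalgebra `S` of `D`. -/
def Variety.quot (S : ℒ.Substructure D) (A : Variety.{u} ℒ D) : Variety.{u} ℒ D where
  carrier := Quotient (subSetoid S A.carrier)
  inVariety := A.inVariety.of_surjective (subMk S A.carrier) Quotient.mk_surjective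

/-- The functors `A ↦ A.quot S`, with the projections `A.quot S₂ ⟶ A.quot S₁` for `S₁ ≤ S₂`. -/
def functorQ : (ℒ.Substructure D)ᵒᵖ ⥤ Variety.{u} ℒ D ⥤ Variety.{u} ℒ D where
  obj S :=
    { obj := fun A => A.quot ℒ D S.unop
      map := fun {A B} φ => subMap (A := A.carrier) (B := B.carrier) le_rfl φ
      map_id := fun A => Variety.hom_ext (A := A.quot ℒ D S.unop) (B := A.quot ℒ D S.unop)
        (Quotient.ind fun _ => rfl)
      map_comp := fun {A _ C} _ _ => Variety.hom_ext (A := A.quot ℒ D S.unop)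
        (B := C.quot ℒ D S.unop) (Quotient.ind fun _ => rfl) }
  map h :=
    { app := fun A => subMap (leOfHom h.unop) (FirstOrder.Language.Hom.id ℒ A.carrier)
      naturality := fun _ _ _ => Variety.hom_ext (Quotient.ind fun _ => rfl) }
  map_id _ := NatTrans.ext (funext fun _ => Variety.hom_ext (Quotient.ind fun _ => rfl))
  map_comp _ _ := NatTrans.ext (funext fun _ => Variety.hom_ext (Quotient.ind fun _ => rfl))

end Quotient

section Skeleton

section Terms

variable (ℒ : FirstOrder.Language.{v, w}) (D : Type u) [ℒ.Structure D] [Lattice D] [BoundedOrder D]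
  [BoundedLatticeReduct ℒ D] {A B : Type*} [ℒ.Structure A] [ℒ.Structure B]

open BoundedLatticeReduct

/-- The lattice operations on an algebra, as defined by the terms that define them on `D`. -/
def opInf (a b : A) : A := (infTerm (ℒ := ℒ) (D := D)).realize ![a, b]
/-- See `opInf`. -/
def opSup (a b : A) : A := (supTerm (ℒ := ℒ) (D := D)).realize ![a, b]
/-- See `opInf`. -/
def opBot : A := (botTerm (ℒ := ℒ) (D := D)).realize ![]
/-- See `opInf`. -/
def opTop : A := (topTerm (ℒ := ℒ) (D := D)).realize ![]

theorem mem_of_top_or_bot (S : ℒ.Substructure D) {x : D} (h : x = ⊤ ∨ x = ⊥) : x ∈ S := by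
  rcases h with rfl | rfl
  · exact realize_top (ℒ := ℒ) (D := D) ![] ▸
      FirstOrder.Language.Term.realize_mem _ _ fun i => i.elim0
  · exact realize_bot (ℒ := ℒ) (D := D) ![] ▸
      FirstOrder.Language.Term.realize_mem _ _ fun i => i.elim0

open Classical in
theorem exists_tTerm [IsSemiPrimal ℒ D] (d : D) : ∃ t : ℒ.Term (Fin 1), ∀ x : Fin 1 → D,
    t.realize x = if x 0 = d then ⊤ else ⊥ :=
  IsSemiPrimal.exists_term 1 le_rfl _ fun S x _ =>
    mem_of_top_or_bot ℒ D S (by split_ifs <;> simp)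

/-- A unary term defining the operation `T_d` on `D`, with `T_d x = 1` if `x = d` and `T_d x = 0`
otherwise. -/
def tTerm [IsSemiPrimal ℒ D] (d : D) : ℒ.Term (Fin 1) := (exists_tTerm ℒ D d).choose

/-- The operation `T_d` on an algebra. -/
def opT [IsSemiPrimal ℒ D] (d : D) (a : A) : A := (tTerm ℒ D d).realize ![a]

section Hom

theorem map_realize₁ (φ : A →[ℒ] B) (t : ℒ.Term (Fin 1)) (a : A) :
    φ (t.realize ![a]) = t.realize ![φ a] := by
  rw [← FirstOrder.Language.HomClass.realize_term]
  congr 1; ext i; fin_cases i; rfl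

theorem map_realize₂ (φ : A →[ℒ] B) (t : ℒ.Term (Fin 2)) (a b : A) :
    φ (t.realize ![a, b]) = t.realize ![φ a, φ b] := by
  rw [← FirstOrder.Language.HomClass.realize_term]
  congr 1; ext i; fin_cases i <;> rfl

theorem map_realize₀ (φ : A →[ℒ] B) (t : ℒ.Term (Fin 0)) : φ (t.realize ![]) = t.realize ![] := by
  rw [← FirstOrder.Language.HomClass.realize_term]
  congr 1; ext i; exact i.elim0

end Hom

section Identities

variable {ℒ D} {n : ℕ}

theorem realize_subst₁ (t : ℒ.Term (Fin 1)) (r : ℒ.Term (Fin n)) (x : Fin n → A) :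
    (t.subst ![r]).realize x = t.realize ![r.realize x] := by
  rw [FirstOrder.Language.Term.realize_subst]
  congr 1; ext i; fin_cases i; rfl

theorem realize_subst₂ (t : ℒ.Term (Fin 2)) (r s : ℒ.Term (Fin n)) (x : Fin n → A) :
    (t.subst ![r, s]).realize x = t.realize ![r.realize x, s.realize x] := by
  rw [FirstOrder.Language.Term.realize_subst]
  congr 1; ext i; fin_cases i <;> rfl

theorem realize_subst₀ (t : ℒ.Term (Fin 0)) (x : Fin n → A) :
    (t.subst (![] : Fin 0 → ℒ.Term (Fin n))).realize x = t.realize ![] := by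
  rw [FirstOrder.Language.Term.realize_subst]
  congr 1; ext i; exact i.elim0

theorem opInf_self (a b : D) : opInf ℒ D a b = a ⊓ b := realize_inf _
theorem opSup_self (a b : D) : opSup ℒ D a b = a ⊔ b := realize_sup _
theorem opBot_self : opBot ℒ D = (⊥ : D) := realize_bot _
theorem opTop_self : opTop ℒ D = (⊤ : D) := realize_top _

open Classical in
theorem opT_self [IsSemiPrimal ℒ D] (d a : D) : opT ℒ D d a = if a = d then ⊤ else ⊥ :=
  (exists_tTerm ℒ D d).choose_spec _

theorem opT_self_cases [IsSemiPrimal ℒ D] (d a : D) : opT ℒ D d a = ⊤ ∨ opT ℒ D d a = ⊥ := by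
  rw [opT_self]; split_ifs <;> simp

theorem opT_top_self [IsSemiPrimal ℒ D] {a : D} (h : a = ⊤ ∨ a = ⊥) : opT ℒ D ⊤ a = a := by
  rw [opT_self]; split_ifs with h' <;> rcases h with rfl | rfl <;> simp_all

theorem opT_bot_self [IsSemiPrimal ℒ D] {a : D} (h : a = ⊤ ∨ a = ⊥) :
    (a = ⊤ ∧ opT ℒ D ⊥ a = ⊥) ∨ (a = ⊥ ∧ opT ℒ D ⊥ a = ⊤) := by
  rw [opT_self]; split_ifs with h' <;> rcases h with rfl | rfl <;> simp_all

variable (ℒ D) in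
/-- Identities of the variety which make the Boolean skeleton a Boolean algebra. -/
structure SkeletonIdentities [IsSemiPrimal ℒ D] (A : Type u) [ℒ.Structure A] : Prop where
  inf_comm (a b : A) : opInf ℒ D a b = opInf ℒ D b a
  sup_comm (a b : A) : opSup ℒ D a b = opSup ℒ D b a
  inf_assoc (a b c : A) : opInf ℒ D (opInf ℒ D a b) c = opInf ℒ D a (opInf ℒ D b c)
  sup_assoc (a b c : A) : opSup ℒ D (opSup ℒ D a b) c = opSup ℒ D a (opSup ℒ D b c)
  sup_inf_self (a b : A) : opSup ℒ D a (opInf ℒ D a b) = a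
  inf_sup_self (a b : A) : opInf ℒ D a (opSup ℒ D a b) = a
  bot_sup (a : A) : opSup ℒ D (opBot ℒ D) a = a
  sup_top (a : A) : opSup ℒ D a (opTop ℒ D) = opTop ℒ D
  inf_mem (a b : A) : opT ℒ D ⊤ (opInf ℒ D (opT ℒ D ⊤ a) (opT ℒ D ⊤ b)) =
    opInf ℒ D (opT ℒ D ⊤ a) (opT ℒ D ⊤ b)
  sup_mem (a b : A) : opT ℒ D ⊤ (opSup ℒ D (opT ℒ D ⊤ a) (opT ℒ D ⊤ b)) =
    opSup ℒ D (opT ℒ D ⊤ a) (opT ℒ D ⊤ b)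
  bot_mem : opT ℒ D ⊤ (opBot ℒ D : A) = opBot ℒ D
  top_mem : opT ℒ D ⊤ (opTop ℒ D : A) = opTop ℒ D
  compl_mem (a : A) : opT ℒ D ⊤ (opT ℒ D ⊥ a) = opT ℒ D ⊥ a
  inf_sup (a b c : A) :
    opInf ℒ D (opT ℒ D ⊤ a) (opSup ℒ D (opT ℒ D ⊤ b) (opT ℒ D ⊤ c)) =
      opSup ℒ D (opInf ℒ D (opT ℒ D ⊤ a) (opT ℒ D ⊤ b)) (opInf ℒ D (opT ℒ D ⊤ a) (opT ℒ D ⊤ c))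
  inf_compl (a : A) : opInf ℒ D (opT ℒ D ⊤ a) (opT ℒ D ⊥ (opT ℒ D ⊤ a)) = opBot ℒ D
  sup_compl (a : A) : opSup ℒ D (opT ℒ D ⊤ a) (opT ℒ D ⊥ (opT ℒ D ⊤ a)) = opTop ℒ D

theorem InVariety.skeletonIdentities [IsSemiPrimal ℒ D] {A : Type u} [ℒ.Structure A]
    (hA : InVariety ℒ D A) : SkeletonIdentities ℒ D A := by
  let x : ℒ.Term (Fin 3) := .var 0
  let y : ℒ.Term (Fin 3) := .var 1
  let z : ℒ.Term (Fin 3) := .var 2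
  let I (r s : ℒ.Term (Fin 3)) := (infTerm (ℒ := ℒ) (D := D)).subst ![r, s]
  let J (r s : ℒ.Term (Fin 3)) := (supTerm (ℒ := ℒ) (D := D)).subst ![r, s]
  let T (d : D) (r : ℒ.Term (Fin 3)) := (tTerm ℒ D d).subst ![r]
  let O : ℒ.Term (Fin 3) := (botTerm (ℒ := ℒ) (D := D)).subst ![]
  let E : ℒ.Term (Fin 3) := (topTerm (ℒ := ℒ) (D := D)).subst ![]
  have hx : ∀ a b c : A, x.realize ![a, b, c] = a := fun _ _ _ => rfl
  have hy : ∀ a b c : A, y.realize ![a, b, c] = b := fun _ _ _ => rfl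
  have hz : ∀ a b c : A, z.realize ![a, b, c] = c := fun _ _ _ => rfl
  have hI : ∀ r s {M : Type u} [ℒ.Structure M] (x : Fin 3 → M),
      (I r s).realize x = opInf ℒ D (r.realize x) (s.realize x) := fun _ _ _ _ _ =>
    realize_subst₂ _ _ _ _
  have hJ : ∀ r s {M : Type u} [ℒ.Structure M] (x : Fin 3 → M),
      (J r s).realize x = opSup ℒ D (r.realize x) (s.realize x) := fun _ _ _ _ _ =>
    realize_subst₂ _ _ _ _
  have hT : ∀ d r {M : Type u} [ℒ.Structure M] (x : Fin 3 → M),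
      (T d r).realize x = opT ℒ D d (r.realize x) := fun _ _ _ _ _ => realize_subst₁ _ _ _
  have hO : ∀ {M : Type u} [ℒ.Structure M] (x : Fin 3 → M), O.realize x = opBot ℒ D :=
    fun _ => realize_subst₀ _ _
  have hE : ∀ {M : Type u} [ℒ.Structure M] (x : Fin 3 → M), E.realize x = opTop ℒ D :=
    fun _ => realize_subst₀ _ _
  have key : ∀ (s t : ℒ.Term (Fin 3)), (∀ v : Fin 3 → D, s.realize v = t.realize v) →
      ∀ a b c : A, s.realize ![a, b, c] = t.realize ![a, b, c] :=
    fun s t h a b c => hA 3 s t h _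
  have hc : ∀ d a : D, opT ℒ D d a = ⊤ ∨ opT ℒ D d a = ⊥ := opT_self_cases
  have hb : ∀ a : D, (opT ℒ D ⊤ a = ⊤ ∧ opT ℒ D ⊥ (opT ℒ D ⊤ a) = ⊥) ∨
      (opT ℒ D ⊤ a = ⊥ ∧ opT ℒ D ⊥ (opT ℒ D ⊤ a) = ⊤) := fun a => opT_bot_self (hc _ _)
  have a₀ : A := opBot ℒ D
  constructor
  · intro a b
    simpa only [hI, hx, hy] using key (I x y) (I y x)
      (by simp only [hI, opInf_self, _root_.inf_comm, implies_true]) a b a₀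
  · intro a b
    simpa only [hJ, hx, hy] using key (J x y) (J y x)
      (by simp only [hJ, opSup_self, _root_.sup_comm, implies_true]) a b a₀
  · intro a b c
    simpa only [hI, hx, hy, hz] using key (I (I x y) z) (I x (I y z))
      (by simp only [hI, opInf_self, _root_.inf_assoc, implies_true]) a b c
  · intro a b c
    simpa only [hJ, hx, hy, hz] using key (J (J x y) z) (J x (J y z))
      (by simp only [hJ, opSup_self, _root_.sup_assoc, implies_true]) a b c
  · intro a b
    simpa only [hI, hJ, hx, hy] using key (J x (I x y)) x
      (by simp only [hI, hJ, opSup_self, opInf_self, _root_.sup_inf_self, implies_true]) a b a₀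
  · intro a b
    simpa only [hI, hJ, hx, hy] using key (I x (J x y)) x
      (by simp only [hI, hJ, opSup_self, opInf_self, _root_.inf_sup_self, implies_true]) a b a₀
  · intro a
    simpa only [hJ, hO, hx] using key (J O x) x
      (by simp only [hJ, hO, opSup_self, opBot_self, bot_sup_eq, implies_true]) a a₀ a₀
  · intro a
    simpa only [hJ, hE, hx] using key (J x E) E
      (by simp only [hJ, hE, opSup_self, opTop_self, sup_top_eq, implies_true]) a a₀ a₀
  · intro a b
    simpa only [hI, hT, hx, hy] using key (T ⊤ (I (T ⊤ x) (T ⊤ y))) (I (T ⊤ x) (T ⊤ y))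
      (fun v => by
        simp only [hI, hT, opInf_self]
        refine opT_top_self ?_
        rcases hc ⊤ (x.realize v) with h | h <;> rcases hc ⊤ (y.realize v) with h' | h' <;>
          simp [h, h']) a b a₀
  · intro a b
    simpa only [hJ, hT, hx, hy] using key (T ⊤ (J (T ⊤ x) (T ⊤ y))) (J (T ⊤ x) (T ⊤ y))
      (fun v => by
        simp only [hJ, hT, opSup_self]
        refine opT_top_self ?_
        rcases hc ⊤ (x.realize v) with h | h <;> rcases hc ⊤ (y.realize v) with h' | h' <;>
          simp [h, h']) a b a₀
  · simpa only [hT, hO] using key (T ⊤ O) O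
      (fun v => by simp only [hT, hO, opBot_self]; exact opT_top_self (.inr rfl)) a₀ a₀ a₀
  · simpa only [hT, hE] using key (T ⊤ E) E
      (fun v => by simp only [hT, hE, opTop_self]; exact opT_top_self (.inl rfl)) a₀ a₀ a₀
  · intro a
    simpa only [hT, hx] using key (T ⊤ (T ⊥ x)) (T ⊥ x)
      (fun v => by simp only [hT]; exact opT_top_self (hc _ _)) a a₀ a₀
  · intro a b c
    simpa only [hI, hJ, hT, hx, hy, hz] using key (I (T ⊤ x) (J (T ⊤ y) (T ⊤ z)))
      (J (I (T ⊤ x) (T ⊤ y)) (I (T ⊤ x) (T ⊤ z)))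
      (fun v => by
        simp only [hI, hJ, hT, opInf_self, opSup_self]
        rcases hc ⊤ (x.realize v) with h | h <;> simp [h]) a b c
  · intro a
    simpa only [hI, hT, hO, hx] using key (I (T ⊤ x) (T ⊥ (T ⊤ x))) O
      (fun v => by
        simp only [hI, hT, hO, opInf_self, opBot_self]
        rcases hb (x.realize v) with ⟨h, h'⟩ | ⟨h, h'⟩ <;> rw [h', h] <;> simp) a a₀ a₀
  · intro a
    simpa only [hJ, hT, hE, hx] using key (J (T ⊤ x) (T ⊥ (T ⊤ x))) E
      (fun v => by
        simp only [hJ, hT, hE, opSup_self, opTop_self]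
        rcases hb (x.realize v) with ⟨h, h'⟩ | ⟨h, h'⟩ <;> rw [h', h] <;> simp) a a₀ a₀

end Identities

end Terms

section BooleanSkeleton

variable (ℒ : FirstOrder.Language.{v, w}) [ℒ.IsAlgebraic] (D : Type u) [ℒ.Structure D]
  [Lattice D] [BoundedOrder D] [BoundedLatticeReduct ℒ D] [IsSemiPrimal ℒ D]

variable {ℒ D} in
/-- The Boolean skeleton of an algebra: the set of all `a` with `T_1 a = a`. -/
def Variety.Skeleton (A : Variety.{u} ℒ D) : Type u := {a : A.carrier // opT ℒ D ⊤ a = a}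

variable {ℒ D} in
/-- The Boolean skeleton is a Boolean algebra with the lattice operations inherited from the algebra
and the negation `T_0`. -/
instance (A : Variety.{u} ℒ D) : BooleanAlgebra A.Skeleton :=
  have ids := A.inVariety.skeletonIdentities
  letI : Max A.Skeleton :=
    ⟨fun a b => ⟨opSup ℒ D a.1 b.1, by simpa only [a.2, b.2] using ids.sup_mem a.1 b.1⟩⟩
  letI : Min A.Skeleton :=
    ⟨fun a b => ⟨opInf ℒ D a.1 b.1, by simpa only [a.2, b.2] using ids.inf_mem a.1 b.1⟩⟩
  letI : Lattice A.Skeleton := Lattice.mk'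
    (fun _ _ => Subtype.ext (ids.sup_comm _ _)) (fun _ _ _ => Subtype.ext (ids.sup_assoc _ _ _))
    (fun _ _ => Subtype.ext (ids.inf_comm _ _)) (fun _ _ _ => Subtype.ext (ids.inf_assoc _ _ _))
    (fun _ _ => Subtype.ext (ids.sup_inf_self _ _)) (fun _ _ => Subtype.ext (ids.inf_sup_self _ _))
  letI : DistribLattice A.Skeleton := DistribLattice.ofInfSupLe fun a b c =>
    le_of_eq (Subtype.ext (by
      have := ids.inf_sup a.1 b.1 c.1
      rw [a.2, b.2, c.2] at this
      exact this))
  { bot := ⟨opBot ℒ D, ids.bot_mem⟩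
    top := ⟨opTop ℒ D, ids.top_mem⟩
    compl := fun a => ⟨opT ℒ D ⊥ a.1, ids.compl_mem a.1⟩
    bot_le := fun a => sup_eq_right.mp (Subtype.ext (ids.bot_sup a.1))
    le_top := fun a => sup_eq_right.mp (Subtype.ext (ids.sup_top a.1))
    inf_compl_le_bot := fun a => le_of_eq (Subtype.ext (by
      have := ids.inf_compl a.1
      rw [a.2] at this
      exact this))
    top_le_sup_compl := fun a => ge_of_eq (Subtype.ext (by
      have := ids.sup_compl a.1
      rw [a.2] at this
      exact this)) }

/-- The Boolean skeleton functor; homomorphisms are restricted to the skeletons. -/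
def functorSkeleton : Variety.{u} ℒ D ⥤ BoolAlg.{u} where
  obj A := BoolAlg.of A.Skeleton
  map {A B} φ := BoolAlg.ofHom
    { toFun := fun a => ⟨FirstOrder.Language.Hom.toFun φ a.1,
        (map_realize₁ ℒ (A := A.carrier) φ (tTerm ℒ D ⊤) a.1).symm.trans
          (congrArg (FirstOrder.Language.Hom.toFun φ) a.2)⟩
      map_sup' := fun a b => Subtype.ext (map_realize₂ ℒ (A := A.carrier) φ _ a.1 b.1)
      map_inf' := fun a b => Subtype.ext (map_realize₂ ℒ (A := A.carrier) φ _ a.1 b.1)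
      map_top' := Subtype.ext (map_realize₀ ℒ (A := A.carrier) φ _)
      map_bot' := Subtype.ext (map_realize₀ ℒ (A := A.carrier) φ _) }

/-- The functors `K_S`: the Boolean skeleton of the quotient of an algebra attached to `S`. -/
def functorK : (ℒ.Substructure D)ᵒᵖ ⥤ Variety.{u} ℒ D ⥤ BoolAlg.{u} :=
  functorQ ℒ D ⋙ (Functor.whiskeringRight _ _ _).obj (functorSkeleton ℒ D)

end BooleanSkeleton

end Skeleton

/-! ### The liftings -/

section LiftStone

variable (ℒ : FirstOrder.Language.{v, w}) (D : Type u) [ℒ.Structure D]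

/-- For a functor `T : Stone ⥤ Stone`, the bifunctor `(S, R) ↦ V^S (T (C^R X))` on the poset of
subalgebras of `D`, depending functorially on `X` in `Stone_D`. -/
def coendDiagram (T : Profinite.{u} ⥤ Profinite.{u}) :
    StoneD.{u} ℒ D ⥤ (ℒ.Substructure D)ᵒᵖ ⥤ ℒ.Substructure D ⥤ StoneD.{u} ℒ D :=
  (functorC ℒ D).flip ⋙ (Functor.whiskeringRight _ _ _).obj (T ⋙ (functorV ℒ D).flip) ⋙
    flipFunctor _ _ _

theorem coendDiagram_obj (T : Profinite.{u} ⥤ Profinite.{u}) (X : StoneD.{u} ℒ D) (S R : ℒ.Substructure D) :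
    (((coendDiagram ℒ D T).obj X).obj (op S)).obj R =
      ((functorV ℒ D).obj (op S)).obj (T.obj (((functorC ℒ D).obj R).obj X)) := rfl

variable {ℒ D}

/-- The labelled Stone space carrying the coend: the space `T (C^D X)`, where a point is labelled by
the intersection of all `S` such that it comes from `T (C^S X)`. -/
def coendObj [Finite D] (T : Profinite.{u} ⥤ Profinite.{u}) (X : StoneD.{u} ℒ D) :
    StoneD.{u} ℒ D where
  space := T.obj (((functorC ℒ D).obj ⊤).obj X)
  val z := sInf {S | z ∈ Set.range (T.map (((functorC ℒ D).map (homOfLE (le_top (a := S)))).app X))}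
  isClosed_le R := by
    let i (S : ℒ.Substructure D) := T.map (((functorC ℒ D).map (homOfLE (le_top (a := S)))).app X)
    have : {z | sInf {S | z ∈ Set.range (i S)} ≤ R} =
        ⋃ 𝒮 ∈ {𝒮 : Set (ℒ.Substructure D) | sInf 𝒮 ≤ R}, ⋂ S ∈ 𝒮, Set.range (i S) := by
      ext z
      simp only [Set.mem_ofPred_eq, Set.mem_iUnion, Set.mem_iInter, exists_prop]
      exact ⟨fun h => ⟨_, h, fun S hS => hS⟩, fun ⟨𝒮, h, h'⟩ => (sInf_le_sInf h').trans h⟩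
    refine this ▸ (Set.toFinite _).isClosed_biUnion fun 𝒮 _ => isClosed_biInter fun S _ => ?_
    exact (isCompact_range (i S).hom.hom.continuous).isClosed

instance [Finite D] (T : Profinite.{u} ⥤ Profinite.{u}) (X : StoneD.{u} ℒ D) :
    Limits.HasCoend ((coendDiagram ℒ D T).obj X) := by
  let i (S : ℒ.Substructure D) := T.map (((functorC ℒ D).map (homOfLE (le_top (a := S)))).app X)
  let c : Limits.Cowedge ((coendDiagram ℒ D T).obj X) := Limits.Cowedge.mk (coendObj T X)
    (fun S => ⟨i S, fun z => sInf_le ⟨z, rfl⟩⟩) (fun S R f => by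
      apply StoneD.hom_ext
      change 𝟙 _ ≫ i S = T.map _ ≫ i R
      rw [Category.id_comp, ← T.map_comp]
      rfl)
  have hi : i ⊤ = 𝟙 _ := T.map_id _
  have hE (E : Limits.Cowedge ((coendDiagram ℒ D T).obj X)) (S : ℒ.Substructure D) :
      (E.π S).hom = i S ≫ (E.π (⊤ : ℒ.Substructure D)).hom := by
    have h := congrArg StoneD.Hom.hom (E.condition (homOfLE (le_top (a := S))))
    let p : T.obj (((functorC ℒ D).obj S).obj X) ⟶ E.pt.space := (E.π S).hom
    change 𝟙 _ ≫ p = _ at h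
    rw [Category.id_comp] at h
    exact h
  refine Limits.HasColimit.mk ⟨c, Limits.Multicofork.IsColimit.mk _
    (fun E => ⟨(E.π (⊤ : ℒ.Substructure D)).hom, fun z => ?_⟩) ?_ ?_⟩
  · refine le_sInf ?_
    rintro S ⟨y, rfl⟩
    have h := (E.π S).val_le y
    rw [hE] at h
    exact h
  · intro E S
    apply StoneD.hom_ext
    exact (hE E S).symm
  · intro E m hm
    apply StoneD.hom_ext
    have h := congrArg StoneD.Hom.hom (hm (⊤ : ℒ.Substructure D))
    let p : T.obj (((functorC ℒ D).obj ⊤).obj X) ⟶ E.pt.space := m.hom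
    change i ⊤ ≫ p = _ at h
    rw [hi, Category.id_comp] at h
    exact h

variable (ℒ D)

/-- The lifting `T'` of a functor `T : Stone ⥤ Stone` to `Stone_D`: an object `X` is sent to the
coend over the subalgebras `S` of `D` of `V^S (T (C^S X))`, and a morphism is sent to the morphism
induced on coends. -/
def liftStone [Finite D] (T : Profinite.{u} ⥤ Profinite.{u}) : StoneD.{u} ℒ D ⥤ StoneD.{u} ℒ D where
  obj X := Limits.coend ((coendDiagram ℒ D T).obj X)
  map f := Limits.coend.map ((coendDiagram ℒ D T).map f)

end LiftStone

section LiftVariety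

variable (ℒ : FirstOrder.Language.{v, w}) [ℒ.IsAlgebraic] (D : Type u) [ℒ.Structure D]

/-- Componentwise operations on families. -/
instance {J : Type*} (M : J → Type*) [∀ j, ℒ.Structure (M j)] : ℒ.Structure (∀ j, M j) where
  funMap g x := fun j => FirstOrder.Language.Structure.funMap g fun i => x i j

section End

variable {ℒ D} {J : Type u} [SmallCategory J] (F : Jᵒᵖ ⥤ J ⥤ Variety.{u} ℒ D)

/-- The algebra of compatible families which carries the end of a bifunctor. -/
def endSubalgebra : ℒ.Substructure (∀ j, ((F.obj (op j)).obj j).carrier) where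
  carrier := {x | ∀ (i j : J) (f : i ⟶ j), FirstOrder.Language.Hom.toFun ((F.obj (op i)).map f) (x i)
    = FirstOrder.Language.Hom.toFun ((F.map f.op).app j) (x j)}
  fun_mem {n} g x hx i j f := by
    refine (FirstOrder.Language.Hom.map_fun' _ _ _).trans
      (Eq.trans ?_ (FirstOrder.Language.Hom.map_fun' _ _ _).symm)
    exact congrArg _ (funext fun k => hx k i j f)

/-- The projections of the algebra of families. -/
def endProj (j : J) : endSubalgebra F →[ℒ] ((F.obj (op j)).obj j).carrier where
  toFun x := x.1 j
  map_fun' _ _ := rfl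
  map_rel' r := isEmptyElim r

/-- The algebra of compatible families, as an object of the variety. -/
def endObj : Variety.{u} ℒ D where
  carrier := endSubalgebra F
  inVariety := .of_separating (fun j => ((F.obj (op j)).obj j).inVariety) (endProj F)
    fun _ _ h => Subtype.ext (funext h)

instance : Limits.HasEnd F := by
  let c : Limits.Wedge F := Limits.Wedge.mk (endObj F) (endProj F) fun i j f =>
    Variety.hom_ext fun x => x.2 i j f
  refine Limits.HasLimit.mk ⟨c, Limits.Multifork.IsLimit.mk _ (fun E =>
    { toFun := fun a => ⟨fun j => FirstOrder.Language.Hom.toFun (E.ι j) a, fun i j f => ?_⟩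
      map_fun' := fun g x => ?_
      map_rel' := fun r => isEmptyElim r }) ?_ ?_⟩
  · exact congrArg (fun φ => FirstOrder.Language.Hom.toFun φ a) (Limits.Wedge.condition E f)
  · exact Subtype.ext (funext fun j => FirstOrder.Language.Hom.map_fun' (E.ι j) g x)
  · exact fun E j => rfl
  · intro E m hm
    exact Variety.hom_ext fun a => Subtype.ext (funext fun j =>
      congrArg (fun φ => FirstOrder.Language.Hom.toFun φ a) (hm j))

end End

variable [Lattice D] [BoundedOrder D] [BoundedLatticeReduct ℒ D] [IsSemiPrimal ℒ D]

/-- For a functor `L : BA ⥤ BA`, the bifunctor `(R, S) ↦ 𝔓_S (L (K_R A))` on the poset of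
subalgebras of `D`, depending functorially on the algebra `A`. -/
def endDiagram (L : BoolAlg.{u} ⥤ BoolAlg.{u}) :
    Variety.{u} ℒ D ⥤ (ℒ.Substructure D)ᵒᵖ ⥤ ℒ.Substructure D ⥤ Variety.{u} ℒ D :=
  (functorK ℒ D).flip ⋙ (Functor.whiskeringRight _ _ _).obj (L ⋙ (functorP ℒ D).flip)

theorem endDiagram_obj (L : BoolAlg.{u} ⥤ BoolAlg.{u}) (A : Variety.{u} ℒ D)
    (R S : ℒ.Substructure D) :
    (((endDiagram ℒ D L).obj A).obj (op R)).obj S =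
      ((functorP ℒ D).obj S).obj (L.obj (((functorK ℒ D).obj (op R)).obj A)) := rfl

/-- The lifting `L'` of a functor `L : BA ⥤ BA` to the variety generated by `D`: an algebra `A` is
sent to the end over the subalgebras `S` of `D` of `𝔓_S (L (K_S A))`, and a homomorphism is sent to
the homomorphism induced on ends. -/
def liftVariety (L : BoolAlg.{u} ⥤ BoolAlg.{u}) : Variety.{u} ℒ D ⥤ Variety.{u} ℒ D where
  obj A := Limits.end_ ((endDiagram ℒ D L).obj A)
  map φ := Limits.end_.map ((endDiagram ℒ D L).map φ)

end LiftVariety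

end

end SemiPrimal

namespace SemiPrimal

noncomputable section

/-! ### Stone duality -/

/-! The heart of the matter is the natural identification C^S Σ' A ≅ Σ K_S A for each subalgebra S:
homomorphisms from A to D with image in S are the same as points of the Boolean skeleton of A/θ_S
(`bijective_subPoint`). A homomorphism u is recovered from its restriction to the skeleton because
the elements T_d(a) tell whether u(a) = d; semi-primality enters only through the terms T_d. No
extension theorem for homomorphisms is needed to reach every point of the skeleton. The space of
these u is compact, and an element of A/θ_S at which all of them vanish is 0 by the very definition
of θ_S, so its image in the Stone space is everything (`Spec.surjective_of_separating`).

Applying T and then Stone duality gives T C^S Σ' A ≅ T Σ K_S A ≅ Σ Π T Σ K_S A ≅ Σ L K_S A, the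
isomorphism `subspaceIso`, which is natural in A and in S.

The functor Π' is represented by D with each point labelled by the subalgebra it generates, so it
turns the coend T' Σ' A into an end. Thus an element of Π' T' Σ' A amounts to a family of continuous
maps T C^S Σ' A → S which is compatible with the inclusions S ≤ R (`section_ext`, `exists_section`).
Transported along `subspaceIso`, this is a compatible family in the Boolean powers S[L K_S A], that
is, an element of L' A. Hence the comparison homomorphism is bijective.

The argument needs 0 ≠ 1 in D. If D is trivial, every algebra of the variety has exactly one element
and there is nothing to prove. -/

/-- A continuous map from a compact space to the Stone space of a Boolean algebra is surjective
if every element vanishing on its image is zero. -/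
theorem Spec.surjective_of_separating {X : Type*} [TopologicalSpace X] [CompactSpace X]
    {B : BoolAlg.{u}} (e : X → Spec B) (he : Continuous e)
    (h : ∀ b : B, (∀ x, e x b = false) → b = ⊥) : Function.Surjective e := by
  intro p
  have hcl : ∀ b : B, IsClosed {x | e x b = true} := fun b =>
    (isClopen_eval (fun (u : Spec B) (b : B) => u b) b {true}).1.preimage he
  have : Nonempty {b : B // p b = true} := ⟨⟨⊤, map_top p⟩⟩
  -- A preimage of p is a point at which all elements of the ultrafilter of p take the value 1.
  -- These closed conditions form a filtered family because the ultrafilter is closed under meets,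
  -- so by compactness each one need only be satisfiable.
  obtain ⟨x, hx⟩ := IsCompact.nonempty_iInter_of_directed_nonempty_isCompact_isClosed
    (fun b : {b : B // p b = true} => {x | e x b.1 = true}) (fun b c => by
      refine ⟨⟨b.1 ⊓ c.1, ?_⟩, fun x hx => ?_, fun x hx => ?_⟩
      · rw [map_inf, b.2, c.2]; rfl
      · have hx : e x (b.1 ⊓ c.1) = true := hx
        rw [map_inf] at hx
        exact (Bool.and_eq_true_iff.mp hx).1
      · have hx : e x (b.1 ⊓ c.1) = true := hx
        rw [map_inf] at hx
        exact (Bool.and_eq_true_iff.mp hx).2)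
    (fun b => by
      by_contra hne
      -- An unsatisfiable condition belongs to an element vanishing on the image, hence to 0, which
      -- is not in the ultrafilter.
      have hb : b.1 = ⊥ := h b.1 fun x => by
        by_contra hx
        exact hne ⟨x, by simpa using hx⟩
      have := b.2
      rw [hb, map_bot] at this
      exact Bool.noConfusion this)
    (fun b => (hcl b.1).isCompact) (fun b => hcl b.1)
  simp only [Set.mem_iInter, Set.mem_ofPred_eq] at hx
  refine ⟨x, DFunLike.ext _ _ fun b => ?_⟩
  cases hb : p b with
  | true => exact hx ⟨b, hb⟩
  | false =>
    -- Outside the ultrafilter the complement is inside it.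
    have hb' : e x bᶜ = true := hx ⟨bᶜ, by rw [map_compl', hb]; rfl⟩
    rw [map_compl'] at hb'
    cases hxb : e x b with
    | true => rw [hxb] at hb'; exact Bool.noConfusion hb'
    | false => rfl

/-- Evaluation at a point, as a point of the Stone space of the algebra of clopen sets. -/
def evalPoint {X : Type u} [TopologicalSpace X] (x : X) :
    Spec (BoolAlg.of (LocallyConstant X Bool)) :=
  ({ toFun := fun f : LocallyConstant X Bool => f x
     map_sup' := fun _ _ => rfl
     map_inf' := fun _ _ => rfl
     map_top' := rfl
     map_bot' := rfl } : BoundedLatticeHom (LocallyConstant X Bool) Bool)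

theorem continuous_evalPoint {X : Type u} [TopologicalSpace X] :
    Continuous (evalPoint (X := X)) :=
  continuous_evalTopology _ _ fun (f : LocallyConstant X Bool) d =>
    f.isLocallyConstant.isOpen_fiber d

/-- Clopen sets separate points, which gives injectivity; a Boolean function vanishing at every
point is 0, so the evaluations exhaust the Stone space. -/
theorem bijective_evalPoint {X : Type u} [TopologicalSpace X] [CompactSpace X] [T2Space X]
    [TotallyDisconnectedSpace X] : Function.Bijective (evalPoint (X := X)) := by
  classical
  constructor
  · intro x y hxy
    by_contra hne
    obtain ⟨U, hU, hx, hy⟩ := exists_isClopen_of_totally_separated hne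
    have h : LocallyConstant.ofIsClopen hU x = LocallyConstant.ofIsClopen hU y := by
      by_contra h
      -- `LocallyConstant.ofIsClopen` takes values in `Fin 2`, with 0 on U; the test for the value 0
      -- turns it into the Boolean indicator of U.
      have := DFunLike.congr_fun hxy
        ((LocallyConstant.ofIsClopen hU).map fun i : Fin 2 => decide (i = 0))
      change decide (LocallyConstant.ofIsClopen hU x = 0) =
        decide (LocallyConstant.ofIsClopen hU y = 0) at this
      simp only [decide_eq_decide] at this
      omega
    have := LocallyConstant.ofIsClopen_fiber_zero hU
    have hx' : x ∈ LocallyConstant.ofIsClopen hU ⁻¹' {0} := this.symm ▸ hx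
    have hy' : y ∈ LocallyConstant.ofIsClopen hU ⁻¹' {0} := h.symm.trans hx'
    exact hy (this ▸ hy')
  · exact Spec.surjective_of_separating _ continuous_evalPoint fun f hf =>
      LocallyConstant.ext hf

/-- The unit of Stone duality on the side of Stone spaces. -/
def stoneUnit (X : Profinite.{u}) : X ⟶ (stoneSpec.obj (stoneAlg.obj (op X))).unop :=
  ConcreteCategory.ofHom (X := X) (Y := (stoneSpec.obj (stoneAlg.obj (op X))).unop)
    ⟨evalPoint, continuous_evalPoint⟩

instance (X : Profinite.{u}) : IsIso (stoneUnit X) :=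
  CompHausLike.isIso_of_bijective _ bijective_evalPoint

/-! ### Points of the Boolean skeleton -/

section Skeleton

variable {ℒ : FirstOrder.Language.{v, w}} [ℒ.IsAlgebraic] {D : Type u} [ℒ.Structure D]
  [Lattice D] [BoundedOrder D] [BoundedLatticeReduct ℒ D] [IsSemiPrimal ℒ D]

section Points

variable {A : Type u} [ℒ.Structure A]

omit [ℒ.IsAlgebraic] in
theorem hom_opT (u : A →[ℒ] D) (d : D) (a : A) : u (opT ℒ D d a) = opT ℒ D d (u a) :=
  map_realize₁ ℒ u _ a

/-- The homomorphism on a quotient induced by a homomorphism with image in `S`. -/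
def liftQuot (S : ℒ.Substructure D) (u : A →[ℒ] D) (hu : u.range ≤ S) :
    Quotient (subSetoid S A) →[ℒ] D where
  toFun := Quotient.lift u fun _ _ h => h u hu
  map_fun' f x := by
    obtain ⟨y, rfl⟩ : ∃ y : _ → A, x = fun i => ⟦y i⟧ :=
      ⟨fun i => (x i).out, funext fun i => (Quotient.out_eq _).symm⟩
    rw [FirstOrder.Language.funMap_quotient_mk']
    exact u.map_fun f y
  map_rel' r := isEmptyElim r

end Points

open Classical in
/-- The restriction of a homomorphism to `D` to the Boolean skeleton. -/
def skeletonPoint [Nontrivial D] (A : Variety.{u} ℒ D) (u : A.carrier →[ℒ] D) :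
    Spec ((functorSkeleton ℒ D).obj A) :=
  have hu : ∀ a : A.Skeleton, u a.1 = ⊤ ∨ u a.1 = ⊥ := fun a => by
    -- Skeleton elements have the form T_1(a), so every homomorphism to D sends them to 0 or 1.
    rw [← a.2, hom_opT]; exact opT_self_cases _ _
  ({ toFun := fun a : A.Skeleton => decide (u a.1 = ⊤)
     map_sup' := fun a b => by
      have h : u (a ⊔ b).1 = u a.1 ⊔ u b.1 :=
        (map_realize₂ ℒ u _ a.1 b.1).trans (opSup_self _ _)
      rw [h]
      rcases hu a with h | h <;> rcases hu b with h' | h' <;> simp [h, h']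
     map_inf' := fun a b => by
      have h : u (a ⊓ b).1 = u a.1 ⊓ u b.1 :=
        (map_realize₂ ℒ u _ a.1 b.1).trans (opInf_self _ _)
      rw [h]
      rcases hu a with h | h <;> rcases hu b with h' | h' <;> simp [h, h']
     map_top' := by
      have h : u (⊤ : A.Skeleton).1 = ⊤ := (map_realize₀ ℒ u _).trans opTop_self
      simp [h]
     map_bot' := by
      have h : u (⊥ : A.Skeleton).1 = ⊥ := (map_realize₀ ℒ u _).trans opBot_self
      simp [h] } : BoundedLatticeHom A.Skeleton Bool)

/-- Since T_d takes only the values 0 and 1 on D, and T_1 fixes both, this holds under every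
homomorphism to D. It supplies the skeleton elements that separate homomorphisms in
`bijective_subPoint`. -/
theorem opT_mem (S : ℒ.Substructure D) (A : Variety.{u} ℒ D) (d : D) (a : A.carrier) :
    opT ℒ D ⊤ (⟦opT ℒ D d a⟧ : Quotient (subSetoid S A.carrier)) = ⟦opT ℒ D d a⟧ := by
  have h : subMk S A.carrier (opT ℒ D ⊤ (opT ℒ D d a)) =
      opT ℒ D ⊤ (subMk S A.carrier (opT ℒ D d a)) := map_realize₁ ℒ _ _ _
  refine h.symm.trans (Quotient.sound fun u _ => ?_)
  rw [hom_opT, hom_opT]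
  exact opT_top_self (opT_self_cases _ _)

variable [Nontrivial D] [Finite D]

/-- The point of the Boolean skeleton of `A.quot S` given by a homomorphism with image in `S`. -/
def subPoint (S : ℒ.Substructure D) (A : Variety.{u} ℒ D)
    (u : ((functorC ℒ D).obj S).obj ((functorSigma ℒ D).obj A).unop) :
    Spec (((functorK ℒ D).obj (op S)).obj A) :=
  skeletonPoint (A.quot ℒ D S) (liftQuot (A := A.carrier) S u.1 u.2)

theorem continuous_subPoint (S : ℒ.Substructure D) (A : Variety.{u} ℒ D) :
    Continuous (subPoint S A) := by
  refine continuous_evalTopology _ _ ?_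
  rintro ⟨a, ha⟩ d
  obtain ⟨a, rfl⟩ := Quotient.exists_rep a
  -- The value at the class of a depends only on u(a), so evaluation at any representative gives the
  -- open set.
  exact ((isClopen_eval (fun (u : Points ℒ D A.carrier) (a : A.carrier) => u a) a
    {c | @decide (c = ⊤) (Classical.propDecidable _) = d}).2).preimage continuous_subtype_val

/-- The elements T_d(a) make restriction to the skeleton injective, and the definition of θ_S makes
the image separating, so compactness gives surjectivity. -/
theorem bijective_subPoint (S : ℒ.Substructure D) (A : Variety.{u} ℒ D) :
    Function.Bijective (subPoint S A) := by
  classical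
  constructor
  · rintro ⟨u : A.carrier →[ℒ] D, hu⟩ ⟨u' : A.carrier →[ℒ] D, hu'⟩ h
    refine Subtype.ext (DFunLike.ext (F := A.carrier →[ℒ] D) u u' fun a => ?_)
    -- The test element T_d(a) with d = u(a) is sent to 1 by u, and to 1 by u' only if u'(a) = u(a).
    have : decide (u (opT ℒ D (u a) a) = ⊤) = decide (u' (opT ℒ D (u a) a) = ⊤) :=
      DFunLike.congr_fun h (⟨⟦opT ℒ D (u a) a⟧, opT_mem S A _ a⟩ : (A.quot ℒ D S).Skeleton)
    rw [decide_eq_decide, hom_opT, hom_opT, opT_self, opT_self, if_pos rfl] at this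
    by_contra hne
    rw [if_neg fun h => hne h.symm] at this
    exact bot_ne_top (this.mp rfl)
  · refine Spec.surjective_of_separating _ (continuous_subPoint S A) ?_
    rintro ⟨a, ha⟩ h
    obtain ⟨a, rfl⟩ := Quotient.exists_rep a
    refine Subtype.ext (Eq.trans (Quotient.sound fun u hu => ?_)
      (map_realize₀ ℒ (subMk S A.carrier) _))
    have h1 : decide (u a = ⊤) = false := h ⟨u, hu⟩
    -- The representative a need not lie in the skeleton of A: T_1(a) = a holds only modulo θ_S,
    -- which suffices for u with image in S.
    have h2 : opT ℒ D ⊤ (u a) = u a := by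
      rw [← hom_opT]
      have h3 : subMk S A.carrier (opT ℒ D ⊤ a) = opT ℒ D ⊤ (subMk S A.carrier a) :=
        map_realize₁ ℒ _ _ _
      exact Quotient.exact (h3.trans ha) u hu
    refine Eq.trans ?_ ((map_realize₀ ℒ u _).trans opBot_self).symm
    rcases opT_self_cases (ℒ := ℒ) (⊤ : D) (u a) with h | h
    · exact absurd (h2.symm.trans h) (of_decide_eq_false h1)
    · exact h2.symm.trans h

/-- The identification of the points of `A` with image in `S` with the points of the Boolean
skeleton of `A.quot S`. -/
def skeletonMap (S : ℒ.Substructure D) (A : Variety.{u} ℒ D) :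
    ((functorC ℒ D).obj S).obj ((functorSigma ℒ D).obj A).unop ⟶
      (stoneSpec.obj (((functorK ℒ D).obj (op S)).obj A)).unop :=
  ConcreteCategory.ofHom
    (X := ((functorC ℒ D).obj S).obj ((functorSigma ℒ D).obj A).unop)
    (Y := (stoneSpec.obj (((functorK ℒ D).obj (op S)).obj A)).unop)
    ⟨subPoint S A, continuous_subPoint S A⟩

instance (S : ℒ.Substructure D) (A : Variety.{u} ℒ D) : IsIso (skeletonMap S A) :=
  CompHausLike.isIso_of_bijective _ (bijective_subPoint S A)

theorem skeletonMap_naturality (S : ℒ.Substructure D) {A B : Variety.{u} ℒ D} (f : A ⟶ B) :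
    ((functorC ℒ D).obj S).map ((functorSigma ℒ D).map f).unop ≫ skeletonMap S A =
      skeletonMap S B ≫ (stoneSpec.map (((functorK ℒ D).obj (op S)).map f)).unop := by
  refine ConcreteCategory.hom_ext _ _ fun u => DFunLike.ext (F := Spec _) _ _ ?_
  rintro ⟨a, ha⟩
  obtain ⟨a, rfl⟩ := Quotient.exists_rep a
  rfl

/-- Both composites evaluate the same u at a representative. This is what matches the coend
relations with the end relations later. -/
theorem skeletonMap_naturality_left {S R : ℒ.Substructure D} (i : S ⟶ R) (A : Variety.{u} ℒ D) :
    ((functorC ℒ D).map i).app ((functorSigma ℒ D).obj A).unop ≫ skeletonMap R A =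
      skeletonMap S A ≫ (stoneSpec.map (((functorK ℒ D).map i.op).app A)).unop := by
  refine ConcreteCategory.hom_ext _ _ fun u => DFunLike.ext (F := Spec _) _ _ ?_
  rintro ⟨a, ha⟩
  obtain ⟨a, rfl⟩ := Quotient.exists_rep a
  rfl

end Skeleton

/-! ### Isomorphisms and ends in the variety -/

section Variety

variable {ℒ : FirstOrder.Language.{v, w}} [ℒ.IsAlgebraic] {D : Type u} [ℒ.Structure D]

/-- A bijective homomorphism of algebras is an isomorphism. -/
theorem Variety.isIso_of_bijective {A B : Variety.{u} ℒ D} (f : A ⟶ B)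
    (hf : Function.Bijective (FirstOrder.Language.Hom.toFun f)) : IsIso f := by
  let e := Equiv.ofBijective _ hf
  let g : B ⟶ A :=
    { toFun := e.symm
      map_fun' := fun {n} s x => by
        refine e.injective ((e.apply_symm_apply _).trans ?_)
        refine Eq.trans ?_ (FirstOrder.Language.Hom.map_fun' f s (e.symm ∘ x)).symm
        exact congrArg _ (funext fun i => (e.apply_symm_apply (x i)).symm)
      map_rel' := fun r => isEmptyElim r }
  exact ⟨g, Variety.hom_ext e.symm_apply_apply, Variety.hom_ext e.apply_symm_apply⟩

/-- Elements of an end of algebras are determined by their projections. -/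
theorem end_ext {J : Type u} [SmallCategory J] (F : Jᵒᵖ ⥤ J ⥤ Variety.{u} ℒ D)
    {x y : (Limits.end_ F).carrier}
    (h : ∀ j, FirstOrder.Language.Hom.toFun (Limits.end_.π F j) x =
      FirstOrder.Language.Hom.toFun (Limits.end_.π F j) y) : x = y := by
  -- The chosen end is known only by its universal property. The map `r` to the concrete algebra of
  -- compatible families is injective because `s` is a retraction of it.
  let r : Limits.end_ F ⟶ endObj F :=
    { toFun := fun a => ⟨fun j => FirstOrder.Language.Hom.toFun (Limits.end_.π F j) a,
        fun i j f => congrArg (fun φ => FirstOrder.Language.Hom.toFun φ a)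
          (Limits.end_.condition F f)⟩
      map_fun' := fun g x => Subtype.ext (funext fun j =>
        FirstOrder.Language.Hom.map_fun' (Limits.end_.π F j) g x)
      map_rel' := fun r => isEmptyElim r }
  let s : endObj F ⟶ Limits.end_ F := Limits.end_.lift (endProj F) fun i j f =>
    Variety.hom_ext fun x => x.2 i j f
  have hrs : r ≫ s = 𝟙 _ := Limits.end_.hom_ext fun j => by
    rw [Category.assoc, Category.id_comp]
    exact congrArg (r ≫ ·) (Limits.end_.lift_π _ _ _)
  have hr : FirstOrder.Language.Hom.toFun r x = FirstOrder.Language.Hom.toFun r y :=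
    Subtype.ext (funext h)
  have hx := fun z => congrArg (fun φ => FirstOrder.Language.Hom.toFun φ z) hrs
  exact (hx x).symm.trans ((congrArg (FirstOrder.Language.Hom.toFun s) hr).trans (hx y))

end Variety

/-! ### Representability of `Π'` -/

section Representability

variable {ℒ : FirstOrder.Language.{v, w}} [ℒ.IsAlgebraic] (D : Type u) [ℒ.Structure D] [Finite D]

variable (ℒ) in
/-- The discrete space `D`, each point being labelled by the subalgebra which it generates. -/
def discreteStoneD : StoneD.{u} ℒ D :=
  let _ : TopologicalSpace D := ⊥
  have : DiscreteTopology D := ⟨rfl⟩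
  { space := Profinite.of D
    -- With this label, the morphism condition at x says that the subalgebra generated by f(x) lies
    -- in v(x), which is exactly f(x) ∈ v(x).
    val := fun d => FirstOrder.Language.Substructure.closure ℒ {d}
    isClosed_le := fun _ => isClosed_discrete (α := D) _ }

variable {D}

/-- A section as a morphism to `discreteStoneD`. -/
def homOfSection {X : StoneD.{u} ℒ D} (α : LocallyConstant X.space D)
    (hα : ∀ x, α x ∈ X.val x) : X ⟶ discreteStoneD ℒ D :=
  let _ : TopologicalSpace D := ⊥
  have : DiscreteTopology D := ⟨rfl⟩
  { hom := ConcreteCategory.ofHom (X := X.space) (Y := (discreteStoneD ℒ D).space)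
      ⟨α, α.isLocallyConstant.continuous⟩
    val_le := fun x => FirstOrder.Language.Substructure.closure_le.mpr
      (Set.singleton_subset_iff.mpr (hα x)) }

/-- A morphism to `discreteStoneD` as a section. -/
def sectionOfHom {X : StoneD.{u} ℒ D} (f : X ⟶ discreteStoneD ℒ D) : X.sections :=
  let _ : TopologicalSpace D := ⊥
  have : DiscreteTopology D := ⟨rfl⟩
  ⟨⟨f.hom, (IsLocallyConstant.iff_continuous (Y := D) _).mpr f.hom.hom.hom.continuous⟩,
    fun x => f.val_le x (FirstOrder.Language.Substructure.subset_closure rfl)⟩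

end Representability

/-! ### Duality of the liftings -/

/-- If `L` is dual to `T`, then the Stone space of `L B` is obtained by applying `T` to the Stone
space of `B`. -/
def specIso {T : Profinite.{u} ⥤ Profinite.{u}} {L : BoolAlg.{u} ⥤ BoolAlg.{u}}
    (h : L ≅ stoneSpec ⋙ T.op ⋙ stoneAlg) (B : BoolAlg.{u}) :
    T.obj (stoneSpec.obj B).unop ≅ (stoneSpec.obj (L.obj B)).unop :=
  asIso (stoneUnit (T.obj (stoneSpec.obj B).unop)) ≪≫ (stoneSpec.mapIso (h.app B)).unop

theorem specIso_naturality {T : Profinite.{u} ⥤ Profinite.{u}} {L : BoolAlg.{u} ⥤ BoolAlg.{u}}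
    (h : L ≅ stoneSpec ⋙ T.op ⋙ stoneAlg) {B C : BoolAlg.{u}} (f : B ⟶ C) :
    T.map (stoneSpec.map f).unop ≫ (specIso h B).hom =
      (specIso h C).hom ≫ (stoneSpec.map (L.map f)).unop := by
  have h2 : (stoneSpec.map (stoneAlg.map (T.map (stoneSpec.map f).unop).op)).unop ≫
      (stoneSpec.map (h.hom.app B)).unop =
        (stoneSpec.map (h.hom.app C)).unop ≫ (stoneSpec.map (L.map f)).unop := by
    have := congrArg (fun k => (stoneSpec.map k).unop) (h.hom.naturality f)
    simp only [Functor.map_comp, unop_comp] at this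
    exact this.symm
  -- Naturality of the Stone unit holds by definition, so only the square for `h` remains.
  exact congrArg (stoneUnit (T.obj (stoneSpec.obj C).unop) ≫ ·) h2

theorem inv_hom_apply {X Y : Profinite.{u}} (e : X ≅ Y) (x : X) : e.inv (e.hom x) = x :=
  ConcreteCategory.congr_hom e.hom_inv_id x

theorem hom_inv_apply {X Y : Profinite.{u}} (e : X ≅ Y) (y : Y) : e.hom (e.inv y) = y :=
  ConcreteCategory.congr_hom e.inv_hom_id y

section Lifting

variable {ℒ : FirstOrder.Language.{v, w}} [ℒ.IsAlgebraic] {D : Type u} [ℒ.Structure D] [Finite D]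

/-! ### Sections over the coend T' X as compatible families -/

section Coend

variable (T : Profinite.{u} ⥤ Profinite.{u})

/-- The underlying continuous maps of the structure maps of the coend `T' X`. -/
def coendMap (X : StoneD.{u} ℒ D) (S : ℒ.Substructure D) :
    T.obj (((functorC ℒ D).obj S).obj X) ⟶ ((liftStone ℒ D T).obj X).space :=
  (Limits.coend.ι ((coendDiagram ℒ D T).obj X) S).hom

omit [ℒ.IsAlgebraic] in
theorem val_coendMap_le (X : StoneD.{u} ℒ D) (S : ℒ.Substructure D)
    (x : T.obj (((functorC ℒ D).obj S).obj X)) :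
    ((liftStone ℒ D T).obj X).val (coendMap T X S x) ≤ S :=
  (Limits.coend.ι ((coendDiagram ℒ D T).obj X) S).val_le x

omit [ℒ.IsAlgebraic] in
theorem map_coendMap (X : StoneD.{u} ℒ D) {S R : ℒ.Substructure D} (i : S ⟶ R) :
    T.map (((functorC ℒ D).map i).app X) ≫ coendMap T X R = coendMap T X S :=
  (congrArg StoneD.Hom.hom (Limits.coend.condition ((coendDiagram ℒ D T).obj X) i)).symm

omit [ℒ.IsAlgebraic] in
theorem coendMap_naturality (S : ℒ.Substructure D) {X Y : StoneD.{u} ℒ D} (f : X ⟶ Y) :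
    coendMap T X S ≫ ((liftStone ℒ D T).map f).hom =
      T.map (((functorC ℒ D).obj S).map f) ≫ coendMap T Y S :=
  congrArg StoneD.Hom.hom (Limits.coend.ι_map ((coendDiagram ℒ D T).map f) S)

/-- Sections of `T' X` are determined by their restrictions. -/
theorem section_ext (X : StoneD.{u} ℒ D) {α β : ((liftStone ℒ D T).obj X).sections}
    (h : ∀ S x, α.1 (coendMap T X S x) = β.1 (coendMap T X S x)) : α = β := by
  -- As morphisms to the representing object, sections fall under the uniqueness part of the
  -- universal property of the coend.
  have key : homOfSection α.1 α.2 = homOfSection β.1 β.2 :=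
    Limits.coend.hom_ext (F := (coendDiagram ℒ D T).obj X) fun S =>
      StoneD.hom_ext (ConcreteCategory.hom_ext _ _ (h S))
  exact congrArg sectionOfHom key

/-- Compatible families of sections of `T (C^S X)` glue to a section of `T' X`. -/
theorem exists_section (X : StoneD.{u} ℒ D)
    (β : ∀ S : ℒ.Substructure D, LocallyConstant (T.obj (((functorC ℒ D).obj S).obj X)) D)
    (hS : ∀ S x, β S x ∈ S)
    (hβ : ∀ {S R : ℒ.Substructure D} (i : S ⟶ R) (x),
      β R (T.map (((functorC ℒ D).map i).app X) x) = β S x) :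
    ∃ α : ((liftStone ℒ D T).obj X).sections, ∀ S x, α.1 (coendMap T X S x) = β S x := by
  let f (S : ℒ.Substructure D) : (((coendDiagram ℒ D T).obj X).obj (op S)).obj S ⟶
      discreteStoneD ℒ D :=
    homOfSection (X := ((functorV ℒ D).obj (op S)).obj (T.obj (((functorC ℒ D).obj S).obj X)))
      (β S) (hS S)
  -- The map from V^R to V^S is the identity on points, so the cowedge condition reduces to `hβ`.
  have hf : ∀ ⦃S R : ℒ.Substructure D⦄ (i : S ⟶ R),
      (((coendDiagram ℒ D T).obj X).map i.op).app S ≫ f S =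
        (((coendDiagram ℒ D T).obj X).obj (op R)).map i ≫ f R := fun S R i =>
    StoneD.hom_ext (ConcreteCategory.hom_ext _ _ fun x => (hβ i x).symm)
  refine ⟨sectionOfHom (Limits.coend.desc f hf), fun S x => ?_⟩
  exact ConcreteCategory.congr_hom
    (congrArg StoneD.Hom.hom (Limits.coend.ι_desc f hf S)) x

end Coend

variable [Lattice D] [BoundedOrder D] [BoundedLatticeReduct ℒ D] [IsSemiPrimal ℒ D]

/-! ### Elements of the end L' A and their components -/

section End

variable (L : BoolAlg.{u} ⥤ BoolAlg.{u})

/-- The projections of the end `L' A`. -/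
def endMap (A : Variety.{u} ℒ D) (S : ℒ.Substructure D) : (liftVariety ℒ D L).obj A ⟶
    ((functorP ℒ D).obj S).obj (L.obj (((functorK ℒ D).obj (op S)).obj A)) :=
  Limits.end_.π ((endDiagram ℒ D L).obj A) S

omit [Finite D] in
theorem endMap_condition (A : Variety.{u} ℒ D) {S R : ℒ.Substructure D} (i : S ⟶ R) :
    endMap L A S ≫ ((functorP ℒ D).map i).app _ =
      endMap L A R ≫ ((functorP ℒ D).obj R).map (L.map (((functorK ℒ D).map i.op).app A)) :=
  Limits.end_.condition ((endDiagram ℒ D L).obj A) i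

/-- The component of an element of `L' A` at `S`, as a function on a Stone space. -/
def component {L : BoolAlg.{u} ⥤ BoolAlg.{u}} (A : Variety.{u} ℒ D) (S : ℒ.Substructure D) 
    (y : ((liftVariety ℒ D L).obj A).carrier) :
    LocallyConstant (Spec (L.obj (((functorK ℒ D).obj (op S)).obj A))) S :=
  FirstOrder.Language.Hom.toFun (endMap L A S) y

-- This is the wedge condition read pointwise in D, where the inclusion of S[B] in R[B] becomes
-- invisible.
omit [Finite D] in
theorem component_map (A : Variety.{u} ℒ D) (y : ((liftVariety ℒ D L).obj A).carrier)
    {S R : ℒ.Substructure D} (i : S ⟶ R) (x) :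
    (component A S y x : D) =
      component A R y ((stoneSpec.map (L.map (((functorK ℒ D).map i.op).app A))).unop x) :=
  congrArg Subtype.val (LocallyConstant.congr_fun
    (congrArg (fun φ => FirstOrder.Language.Hom.toFun φ y) (endMap_condition L A i)) x)

omit [Finite D] in
theorem endMap_naturality {A B : Variety.{u} ℒ D} (f : A ⟶ B) (S : ℒ.Substructure D) :
    (liftVariety ℒ D L).map f ≫ endMap L B S =
      endMap L A S ≫ ((functorP ℒ D).obj S).map (L.map (((functorK ℒ D).obj (op S)).map f)) :=
  Limits.end_.map_π ((endDiagram ℒ D L).map f) S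

end End

/-! ### The comparison homomorphism and its bijectivity -/

variable [Nontrivial D] {T : Profinite.{u} ⥤ Profinite.{u}} {L : BoolAlg.{u} ⥤ BoolAlg.{u}}
  (h : L ≅ stoneSpec ⋙ T.op ⋙ stoneAlg)

/-- The identification of `T (C^S A)` with the Stone space of `L (K_S A)`, where `C^S A` is the
space of points of `A` with image in `S`. -/
def subspaceIso (S : ℒ.Substructure D) (A : Variety.{u} ℒ D) :
    T.obj (((functorC ℒ D).obj S).obj ((functorSigma ℒ D).obj A).unop) ≅
      (stoneSpec.obj (L.obj (((functorK ℒ D).obj (op S)).obj A))).unop :=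
  T.mapIso (asIso (skeletonMap S A)) ≪≫ specIso h _

theorem subspaceIso_hom (S : ℒ.Substructure D) (A : Variety.{u} ℒ D) :
    (subspaceIso h S A).hom = T.map (skeletonMap S A) ≫ (specIso h _).hom := rfl

theorem subspaceIso_naturality (S : ℒ.Substructure D) {A B : Variety.{u} ℒ D} (f : A ⟶ B) :
    (stoneSpec.map (L.map (((functorK ℒ D).obj (op S)).map f))).unop ≫
        (subspaceIso h S A).inv =
      (subspaceIso h S B).inv ≫
        T.map (((functorC ℒ D).obj S).map ((functorSigma ℒ D).map f).unop) := by
  rw [Iso.comp_inv_eq, Category.assoc, Iso.eq_inv_comp, subspaceIso_hom, subspaceIso_hom,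
    Category.assoc, ← specIso_naturality, ← T.map_comp_assoc, ← T.map_comp_assoc,
    skeletonMap_naturality]

theorem subspaceIso_naturality_left {S R : ℒ.Substructure D} (i : S ⟶ R) (A : Variety.{u} ℒ D) :
    (stoneSpec.map (L.map (((functorK ℒ D).map i.op).app A))).unop ≫ (subspaceIso h R A).inv =
      (subspaceIso h S A).inv ≫
        T.map (((functorC ℒ D).map i).app ((functorSigma ℒ D).obj A).unop) := by
  rw [Iso.comp_inv_eq, Category.assoc, Iso.eq_inv_comp, subspaceIso_hom, subspaceIso_hom,
    Category.assoc, ← specIso_naturality, ← T.map_comp_assoc, ← T.map_comp_assoc,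
    skeletonMap_naturality_left]

/-- The components at `S` of the comparison between `Π' (T' (Σ' A))` and `L' A`. -/
def compareAt (A : Variety.{u} ℒ D) (S : ℒ.Substructure D) :
    (functorSigma ℒ D ⋙ (liftStone ℒ D T).op ⋙ functorPi ℒ D).obj A ⟶
      ((functorP ℒ D).obj S).obj (L.obj (((functorK ℒ D).obj (op S)).obj A)) :=
  let g := (subspaceIso h S A).inv ≫ coendMap T ((functorSigma ℒ D).obj A).unop S
  -- The point g(x) comes from T C^S Σ' A, so its label is at most S and the section takes a value
  -- in S there.
  { toFun := fun α => ⟨fun x => ⟨α.1 (g x), val_coendMap_le T _ S _ (α.2 (g x))⟩, by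
      have : IsLocallyConstant (α.1 ∘ g) :=
        α.1.isLocallyConstant.comp_continuous g.hom.hom.continuous
      exact (IsLocallyConstant.iff_exists_open _).mpr fun x => by
        obtain ⟨U, hU, hx, h⟩ := (IsLocallyConstant.iff_exists_open _).mp this x
        exact ⟨U, hU, hx, fun y hy => Subtype.ext (h y hy)⟩⟩
    map_fun' := fun _ _ => rfl
    map_rel' := fun r => isEmptyElim r }

/-- The comparison between `Π' (T' (Σ' A))` and `L' A`. -/
def compare (A : Variety.{u} ℒ D) :
    (functorSigma ℒ D ⋙ (liftStone ℒ D T).op ⋙ functorPi ℒ D).obj A ⟶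
      (liftVariety ℒ D L).obj A :=
  Limits.end_.lift (F := (endDiagram ℒ D L).obj A) (compareAt h A) fun S R i => by
    refine Variety.hom_ext fun α => LocallyConstant.ext fun x => Subtype.ext ?_
    refine congrArg α.1 ?_
    have := congrArg (fun k => k ≫ coendMap T _ R) (subspaceIso_naturality_left h i A)
    simp only [Category.assoc] at this
    rw [map_coendMap] at this
    exact (ConcreteCategory.congr_hom this x).symm

theorem compare_endMap (A : Variety.{u} ℒ D) (S : ℒ.Substructure D) :
    compare h A ≫ endMap L A S = compareAt h A S :=
  Limits.end_.lift_π (F := (endDiagram ℒ D L).obj A) (compareAt h A) _ S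

/-- On each projection of the end, both sides evaluate α at a point of T' Σ' A; the two points agree
by naturality of `subspaceIso` and of the coend maps. -/
theorem compare_naturality {A B : Variety.{u} ℒ D} (f : A ⟶ B) :
    (functorSigma ℒ D ⋙ (liftStone ℒ D T).op ⋙ functorPi ℒ D).map f ≫ compare h B =
      compare h A ≫ (liftVariety ℒ D L).map f := by
  refine Limits.end_.hom_ext (F := (endDiagram ℒ D L).obj B) fun S => ?_
  change (_ ≫ _) ≫ endMap L B S = (_ ≫ _) ≫ endMap L B S
  refine (Category.assoc _ _ _).trans (Eq.trans ?_ (Category.assoc _ _ _).symm)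
  rw [endMap_naturality, compare_endMap, ← Category.assoc, compare_endMap]
  refine Variety.hom_ext fun α => LocallyConstant.ext fun x => Subtype.ext ?_
  refine congrArg α.1 ?_
  have := congrArg (fun k => k ≫ coendMap T _ S) (subspaceIso_naturality h S f)
  simp only [Category.assoc] at this
  rw [← coendMap_naturality] at this
  exact (ConcreteCategory.congr_hom this x).symm

theorem component_compare (A : Variety.{u} ℒ D) (S : ℒ.Substructure D)
    (α : ((liftStone ℒ D T).obj ((functorSigma ℒ D).obj A).unop).sections)
    (x : (stoneSpec.obj (L.obj (((functorK ℒ D).obj (op S)).obj A))).unop) :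
    (component A S (FirstOrder.Language.Hom.toFun (compare h A) α) x : D) =
      α.1 (coendMap T ((functorSigma ℒ D).obj A).unop S ((subspaceIso h S A).inv x)) := by
  have h1 := congrArg (fun φ => FirstOrder.Language.Hom.toFun φ α) (compare_endMap h A S)
  exact congrArg Subtype.val (LocallyConstant.congr_fun h1 x)

/-- The components of the image record the values of the section on each T C^S Σ' A, up to the
bijection `subspaceIso`, and these values determine it. -/
theorem injective_compare (A : Variety.{u} ℒ D) :
    Function.Injective (FirstOrder.Language.Hom.toFun (compare h A)) := by
  have key : ∀ α β : ((liftStone ℒ D T).obj ((functorSigma ℒ D).obj A).unop).sections,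
      FirstOrder.Language.Hom.toFun (compare h A) α =
        FirstOrder.Language.Hom.toFun (compare h A) β → α = β := by
    intro α β hαβ
    refine section_ext T _ fun S x => ?_
    have h3 : (subspaceIso h S A).inv ((subspaceIso h S A).hom x) = x :=
      inv_hom_apply (subspaceIso h S A) x
    have h4 := (component_compare h A S α ((subspaceIso h S A).hom x)).symm.trans
      ((congrArg (fun y => (component A S y ((subspaceIso h S A).hom x)).1) hαβ).trans
        (component_compare h A S β ((subspaceIso h S A).hom x)))
    rw [h3] at h4
    exact h4
  exact key

theorem subspaceIso_hom_apply {S R : ℒ.Substructure D} (i : S ⟶ R) (A : Variety.{u} ℒ D) (x) :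
    (subspaceIso h R A).hom (T.map (((functorC ℒ D).map i).app ((functorSigma ℒ D).obj A).unop) x) =
      (stoneSpec.map (L.map (((functorK ℒ D).map i.op).app A))).unop
        ((subspaceIso h S A).hom x) := by
  have := subspaceIso_naturality_left h i A
  rw [Iso.comp_inv_eq, Category.assoc, Iso.eq_inv_comp] at this
  exact (ConcreteCategory.congr_hom this x).symm

/-- The components of an element of the end, pulled back along `subspaceIso`, satisfy the gluing
conditions of `exists_section`: these are the wedge conditions in transported form. -/
theorem surjective_compare (A : Variety.{u} ℒ D) :
    Function.Surjective (FirstOrder.Language.Hom.toFun (compare h A)) := by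
  intro y
  obtain ⟨α, hα⟩ := exists_section T ((functorSigma ℒ D).obj A).unop
    (fun S => ((component A S y).map Subtype.val).comap (subspaceIso h S A).hom.hom.hom)
    (fun S x => (component A S y ((subspaceIso h S A).hom x)).2) (fun {S R} i x =>
      (congrArg (fun z => (component A R y z).1) (subspaceIso_hom_apply h i A x)).trans
        (component_map L A y i _).symm)
  have key : ∀ S, component A S (FirstOrder.Language.Hom.toFun (compare h A) α) =
      component A S y := fun S => LocallyConstant.ext fun x => Subtype.ext <| by
    have h3 : (subspaceIso h S A).hom ((subspaceIso h S A).inv x) = x :=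
      hom_inv_apply (subspaceIso h S A) x
    refine (component_compare h A S α x).trans ((hα S _).trans ?_)
    exact congrArg (fun z => (component A S y z).1) h3
  exact ⟨α, end_ext ((endDiagram ℒ D L).obj A) key⟩

/-- The duality of the liftings in the case where `D` is nontrivial. -/
def liftIso : liftVariety ℒ D L ≅ functorSigma ℒ D ⋙ (liftStone ℒ D T).op ⋙ functorPi ℒ D :=
  have (A : Variety.{u} ℒ D) : IsIso (compare h A) :=
    Variety.isIso_of_bijective _ ⟨injective_compare h A, surjective_compare h A⟩
  (NatIso.ofComponents (fun A => asIso (compare h A)) (compare_naturality h)).symm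

end Lifting

/-! ### The trivial case -/

section Trivial

variable {ℒ : FirstOrder.Language.{v, w}} [ℒ.IsAlgebraic] {D : Type u} [ℒ.Structure D]

omit [ℒ.IsAlgebraic] in
theorem InVariety.subsingleton [Subsingleton D] {A : Type u} [ℒ.Structure A]
    (hA : InVariety ℒ D A) : Subsingleton A :=
  ⟨fun a b => hA 2 (.var 0) (.var 1) (fun _ => Subsingleton.elim _ _) ![a, b]⟩

/-- If `D` is trivial, then any two functors to the variety generated by `D` are isomorphic. -/
def isoOfSubsingleton [Lattice D] [BoundedOrder D] [BoundedLatticeReduct ℒ D] [Subsingleton D]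
    {C : Type*} [Category* C] (F G : C ⥤ Variety.{u} ℒ D) : F ≅ G :=
  have (A : Variety.{u} ℒ D) : Subsingleton A.carrier := A.inVariety.subsingleton
  let t (A B : Variety.{u} ℒ D) : A ⟶ B :=
    -- The closed term for 0 ensures that no algebra of the variety is empty.
    { toFun := fun _ => opBot ℒ D
      map_fun' := fun _ _ => Subsingleton.elim _ _
      map_rel' := fun r => isEmptyElim r }
  have ht {A B : Variety.{u} ℒ D} (f g : A ⟶ B) : f = g :=
    Variety.hom_ext fun _ => Subsingleton.elim _ _
  NatIso.ofComponents (fun X => ⟨t (F.obj X) (G.obj X), t (G.obj X) (F.obj X), ht _ _, ht _ _⟩)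
    fun _ => ht _ _

end Trivial

end

end SemiPrimal

open SemiPrimal in
theorem theorem3p4 (ℒ : FirstOrder.Language.{v, w}) [ℒ.IsAlgebraic] (D : Type u) [ℒ.Structure D]
    [Lattice D] [BoundedOrder D] [BoundedLatticeReduct ℒ D] [Finite D] [IsSemiPrimal ℒ D]
    (T : Profinite.{u} ⥤ Profinite.{u}) (L : BoolAlg.{u} ⥤ BoolAlg.{u})
    (h : Nonempty (L ≅ stoneSpec ⋙ T.op ⋙ stoneAlg)) :
    Nonempty (liftVariety ℒ D L ≅
      functorSigma ℒ D ⋙ (liftStone ℒ D T).op ⋙ functorPi ℒ D) := by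
  obtain ⟨h⟩ := h
  -- For trivial D the identification C^S Σ' A ≅ Σ K_S A fails: the left side has one point, while
  -- the one-element Boolean algebra has empty Stone space. Hence the separate case.
  cases subsingleton_or_nontrivial D
  · exact ⟨isoOfSubsingleton _ _⟩
  · exact ⟨liftIso h⟩
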